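/- Let $\lambda>0$, $P>0$, $\theta>0$, $\alpha>2$ and $0<a<R$. Base stations are scattered in the plane outside the disc $\{r<a\}$ around the origin according to a homogeneous Poisson point process of intensity $\lambda$; let $r_i$ be the distance of the $i$-th base station from the origin. The channel gains $g_i$ of the base stations are independent copies of a non-negative random variable $G$ with $\mathbb E[G]<\infty$, and are independent of the point process. Put $$X=\sum_{i:\,a\le r_i<R} g_i P r_i^{-\alpha},\qquad Y=\sum_{j:\,r_j\ge R} g_j P r_j^{-\alpha},\qquad \Omega=\theta Y-X .$$ For a random variable $Z$ write $\mathcal M_Z(t)=\mathbb E[e^{-tZ}]$ for its moment generating function and $\mathcal K_Z(t)=\log\mathcal M_Z(t)$ for its cumulant generating function (note the sign convention). Then $X$ and $Y$ are almost surely finite, and the following holds for every real $t$. The expectation $\mathcal M_\Omega(t)$ is finite if and only if $\mathcal M_G(-tPr^{-\alpha})$ is finite for all $r\in(a,R)$, $\mathcal M_G(t\theta Pr^{-\alpha})$ is finite for all $r>R$, and both integrals below converge absolutely; and in that case $$\mathcal K_\Omega(t)=2\pi\lambda\Big[\int_a^R\big(\mathcal M_G(-tPr^{-\alpha})-1\big)\,r\,\mathrm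 dr+\int_R^\infty\big(\mathcal M_G(t\theta Pr^{-\alpha})-1\big)\,r\,\mathrm dr\Big].$$ -/

import Mathlib

open MeasureTheory ProbabilityTheory Set
open scoped ENNReal NNReal

noncomputable section

/-- The Euclidean plane, in which the base stations are scattered; the user sits at the origin. -/
abbrev Plane : Type := EuclideanSpace ℝ (Fin 2)

/-- The random counting measure `∑ i, δ_{x i}` of the points `x 0, x 1, …`: its value on a Borel
set `B` is the number of indices `i` with `x i ∈ B`. -/
def countingMeasure {Ω : Type*} (x : ℕ → Ω → Plane) (ω : Ω) : Measure Plane :=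
  Measure.sum fun i => Measure.dirac (x i ω)

/-- The random points `x 0, x 1, …`, as far as they lie in the region `S`, form a homogeneous
Poisson point process of intensity `lam` on `S`: the number of points in a bounded Borel set
`B ⊆ S` is Poisson distributed with mean `lam * area B`, and the numbers of points in finitely
many pairwise disjoint such sets are independent. Nothing is said on points outside `S`. -/
structure IsHomogeneousPPPOn {Ω : Type*} [MeasurableSpace Ω] (S : Set Plane) (lam : ℝ≥0)
    (x : ℕ → Ω → Plane) (μ : Measure Ω) : Prop where
  measurable : ∀ i, Measurable (x i)
  hasLaw_count : ∀ B : Set Plane, MeasurableSet B → Bornology.IsBounded B → B ⊆ S →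
    HasLaw (fun ω => countingMeasure x ω B)
      ((poissonMeasure (lam * (volume B).toNNReal)).map (fun n : ℕ => (n : ℝ≥0∞))) μ
  indep_count : ∀ (n : ℕ) (B : Fin n → Set Plane), (∀ j, MeasurableSet (B j)) →
    (∀ j, Bornology.IsBounded (B j)) → (∀ j, B j ⊆ S) → Pairwise (Function.onFun Disjoint B) →
    iIndepFun (fun j ω => countingMeasure x ω (B j)) μ

/-- The marks `g 0, g 1, …` of the points `x 0, x 1, …` are i.i.d. copies of `G` and independent
of the points. -/
structure IsIIDMarking {Ω Ω' : Type*} [MeasurableSpace Ω] [MeasurableSpace Ω']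
    (g : ℕ → Ω → ℝ) (x : ℕ → Ω → Plane) (μ : Measure Ω) (G : Ω' → ℝ) (μ' : Measure Ω') :
    Prop where
  identDistrib : ∀ i, IdentDistrib (g i) G μ μ'
  indep : iIndepFun g μ
  indep_points : IndepFun (fun ω i => x i ω) (fun ω i => g i ω) μ

/-- The region of cooperation, the annulus `a ≤ r < R`. -/
def coopRegion (a R : ℝ) : Set Plane := {y | a ≤ ‖y‖ ∧ ‖y‖ < R}

/-- The region of interference, `r ≥ R`. -/
def interfRegion (R : ℝ) : Set Plane := {y | R ≤ ‖y‖}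

open Classical in
/-- The power that the user receives from the `i`-th base station if that station lies in `A`
(zero otherwise): transmit power `P`, channel gain `g i`, path loss `r ^ (-α)`. -/
def powerTerm {Ω : Type*} (P α : ℝ) (x : ℕ → Ω → Plane) (g : ℕ → Ω → ℝ) (A : Set Plane)
    (ω : Ω) (i : ℕ) : ℝ :=
  if x i ω ∈ A then g i ω * P * ‖x i ω‖ ^ (-α) else 0

/-- The total power that the user receives from the base stations in `A`. -/
def totalPower {Ω : Type*} (P α : ℝ) (x : ℕ → Ω → Plane) (g : ℕ → Ω → ℝ) (A : Set Plane)
    (ω : Ω) : ℝ :=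
  ∑' i, powerTerm P α x g A ω i

/-- The random variable `Ω = θ Y - X`, where `X` is the power of the useful signal and `Y` the
power of the interference. -/
def outageVar {Ω : Type*} (P α a R θ : ℝ) (x : ℕ → Ω → Plane) (g : ℕ → Ω → ℝ) (ω : Ω) : ℝ :=
  θ * totalPower P α x g (interfRegion R) ω - totalPower P α x g (coopRegion a R) ω

/-- The moment generating function of `X` is finite at `t`; sign convention `𝔼[exp (-t X)]`. -/
def MGFExists {Ω : Type*} [MeasurableSpace Ω] (X : Ω → ℝ) (μ : Measure Ω) (t : ℝ) : Prop :=
  Integrable (fun ω => Real.exp (-t * X ω)) μ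

/-- The moment generating function `M_X(t) = 𝔼[exp (-t X)]`. -/
def negMGF {Ω : Type*} [MeasurableSpace Ω] (X : Ω → ℝ) (μ : Measure Ω) (t : ℝ) : ℝ :=
  ∫ ω, Real.exp (-t * X ω) ∂μ

/-- The cumulant generating function `K_X(t) = log M_X(t)`. -/
def negCGF {Ω : Type*} [MeasurableSpace Ω] (X : Ω → ℝ) (μ : Measure Ω) (t : ℝ) : ℝ :=
  Real.log (negMGF X μ t)

end

/-! ### Poisson counts: exponential moments and intensity measure -/

section PoissonCounts

open Filter Topology

/-! Since `-tΩ = tX - tθY`, for either sign of `t` the exponent is a difference of two non-negative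
sums `∑ φ(xᵢ, gᵢ) - ∑ ψ(xᵢ, gᵢ)` over disjoint regions; the sign of `t` only decides which region
carries `φ`. The formula is the Laplace functional of a marked Poisson process, `𝔼 exp (∑ f(xᵢ, gᵢ))
= exp (λ ∫∫ (e^f - 1) dν dy)` with `ν` the law of `G`, taken at `f = φ - ψ` and written in polar
coordinates.

For bounded `f` with bounded support this is elementary. A simple function of the points alone gives
a finite combination of independent Poisson counts, and dominated convergence extends the formula to
measurable functions (`lintegral_exp_tsum`). Marks are integrated out given the points, which turns
`f` into `log ∫ e^f dν`, a function of the points alone (`lintegral_exp_tsum_marks`).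

The general case truncates `φ` and `ψ`. The `ψ` part is harmless: `1 - e^{-ψ} ≤ ψ`, whose integral
is finite because `𝔼 G < ∞`, `α > 2` and `a > 0`. The `φ` part increases with the truncation, so the
limit exists in `[0, ∞]` and is finite exactly when `∫∫ (e^φ - 1)` is
(`lintegral_exp_tsum_sub_tsum`). Finiteness of that integral gives `M_G` finite at almost every
radius; monotonicity in the radius upgrades this to every radius of the open interval
(`integrable_exp_mul_abs_of_lintegral_ne_top`). -/

lemma countingMeasure_apply {Ω : Type*} (x : ℕ → Ω → Plane) (ω : Ω) {B : Set Plane} (hB : MeasurableSet B) :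
    countingMeasure x ω B = ∑' i, B.indicator 1 (x i ω) := by
  rw [countingMeasure, Measure.sum_apply _ hB]
  exact tsum_congr fun i => Measure.dirac_apply' _ hB

lemma countingMeasure_eq_encard {Ω : Type*} (x : ℕ → Ω → Plane) (ω : Ω) {B : Set Plane}
    (hB : MeasurableSet B) :
    countingMeasure x ω B = ({i | x i ω ∈ B}.encard : ℝ≥0∞) := by
  rw [countingMeasure_apply x ω hB, ← ENNReal.tsum_set_one, tsum_subtype {i | x i ω ∈ B} fun _ => (1 : ℝ≥0∞)]
  rfl

variable {Ω : Type*} [MeasurableSpace Ω] {μ : Measure Ω} {S : Set Plane} {lam : ℝ≥0}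
  {x : ℕ → Ω → Plane}

lemma measurable_countingMeasure (hx : ∀ i, Measurable (x i)) {B : Set Plane}
    (hB : MeasurableSet B) : Measurable fun ω => countingMeasure x ω B := by
  simp_rw [countingMeasure_apply x _ hB]
  exact Measurable.tsum fun i => (measurable_one.indicator hB).comp (hx i)

lemma lintegral_exp_mul_poissonMeasure (r : ℝ≥0) (c : ℝ) :
    ∫⁻ n : ℕ, ENNReal.ofReal (Real.exp (c * n)) ∂poissonMeasure r =
      ENNReal.ofReal (Real.exp (r * (Real.exp c - 1))) := by
  have hs : HasSum (fun n : ℕ => Real.exp (-r) * r ^ n / (n.factorial : ℝ) * Real.exp (c * n))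
      (Real.exp (r * (Real.exp c - 1))) := by
    have h := (NormedSpace.expSeries_div_hasSum_exp ((r : ℝ) * Real.exp c)).mul_left
      (Real.exp (-r))
    rw [← Real.exp_eq_exp_ℝ, ← Real.exp_add] at h
    convert! h using 1
    · ext n
      rw [mul_pow, ← Real.exp_nat_mul, mul_comm c]
      ring
    · ring_nf
  rw [poissonMeasure, lintegral_sum_measure]
  simp_rw [lintegral_smul_measure, lintegral_dirac, smul_eq_mul]
  rw [← hs.tsum_eq, ENNReal.ofReal_tsum_of_nonneg (fun n => by positivity) hs.summable]
  exact tsum_congr fun n => (ENNReal.ofReal_mul (by positivity)).symm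

lemma lintegral_natCast_poissonMeasure (r : ℝ≥0) :
    ∫⁻ n : ℕ, (n : ℝ≥0∞) ∂poissonMeasure r = r := by
  have hs : HasSum (fun n : ℕ => Real.exp (-r) * r ^ n / (n.factorial : ℝ) * n) r := by
    -- The term `n = 0` vanishes, and `(n + 1) r ^ (n + 1) / (n + 1)! = r * (r ^ n / n!)` leaves `r`
    -- times the Poisson masses.
    rw [← hasSum_nat_add_iff' 1]
    have h := (hasSum_one_poissonMeasure r).mul_left (r : ℝ)
    convert! h using 1
    · ext n
      rw [Nat.factorial_succ]
      push_cast
      field_simp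
      ring
    · simp
  rw [poissonMeasure, lintegral_sum_measure]
  simp_rw [lintegral_smul_measure, lintegral_dirac, smul_eq_mul]
  rw [← ENNReal.ofReal_coe_nnreal, ← congrArg ENNReal.ofReal hs.tsum_eq,
    ENNReal.ofReal_tsum_of_nonneg (fun n => by positivity) hs.summable]
  exact tsum_congr fun n => by rw [ENNReal.ofReal_mul (by positivity), ENNReal.ofReal_natCast]

lemma finite_setOf_mem_of_count_lt_top {Ω : Type*} {x : ℕ → Ω → Plane} {ω : Ω} {B : Set Plane}
    (hB : MeasurableSet B) (h : countingMeasure x ω B < ∞) : {i | x i ω ∈ B}.Finite := by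
  rw [countingMeasure_eq_encard x ω hB] at h
  exact Set.encard_lt_top_iff.1 (by simpa using h)

lemma toReal_count_eq_sum {Ω : Type*} {x : ℕ → Ω → Plane} {ω : Ω} {B : Set Plane}
    (hB : MeasurableSet B) {I : Finset ℕ} (hI : ∀ i, x i ω ∈ B → i ∈ I) :
    (countingMeasure x ω B).toReal = ∑ i ∈ I, B.indicator (fun _ => (1 : ℝ)) (x i ω) := by
  rw [countingMeasure_apply x ω hB, tsum_eq_sum (s := I) fun i hi =>
    indicator_of_notMem (fun h => hi (hI i h)) _, ENNReal.toReal_sum fun i _ => by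
      by_cases h : x i ω ∈ B <;> simp [h]]
  exact Finset.sum_congr rfl fun i _ => by by_cases h : x i ω ∈ B <;> simp [h]

namespace IsHomogeneousPPPOn

lemma lintegral_comp_count (hx : IsHomogeneousPPPOn S lam x μ) {B : Set Plane}
    (hB : MeasurableSet B) (hb : Bornology.IsBounded B) (hBS : B ⊆ S) {φ : ℝ≥0∞ → ℝ≥0∞}
    (hφ : Measurable φ) :
    ∫⁻ ω, φ (countingMeasure x ω B) ∂μ =
      ∫⁻ n : ℕ, φ n ∂poissonMeasure (lam * (volume B).toNNReal) := by
  rw [(hx.hasLaw_count B hB hb hBS).lintegral_comp hφ.aemeasurable,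
    lintegral_map hφ Measurable.of_discrete]

lemma lintegral_count_of_isBounded (hx : IsHomogeneousPPPOn S lam x μ) {B : Set Plane}
    (hB : MeasurableSet B) (hb : Bornology.IsBounded B) (hBS : B ⊆ S) :
    ∫⁻ ω, countingMeasure x ω B ∂μ = lam * volume B := by
  rw [hx.lintegral_comp_count hB hb hBS (φ := fun n => n) measurable_id,
    lintegral_natCast_poissonMeasure, ENNReal.coe_mul, ENNReal.coe_toNNReal hb.measure_lt_top.ne]

lemma ae_count_lt_top (hx : IsHomogeneousPPPOn S lam x μ) {B : Set Plane}
    (hB : MeasurableSet B) (hb : Bornology.IsBounded B) (hBS : B ⊆ S) :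
    ∀ᵐ ω ∂μ, countingMeasure x ω B < ∞ := by
  refine ae_lt_top (measurable_countingMeasure hx.measurable hB) ?_
  rw [hx.lintegral_count_of_isBounded hB hb hBS]
  exact ENNReal.mul_ne_top ENNReal.coe_ne_top hb.measure_lt_top.ne

lemma lintegral_exp_mul_count (hx : IsHomogeneousPPPOn S lam x μ) {B : Set Plane}
    (hB : MeasurableSet B) (hb : Bornology.IsBounded B) (hBS : B ⊆ S) (c : ℝ) :
    ∫⁻ ω, ENNReal.ofReal (Real.exp (c * (countingMeasure x ω B).toReal)) ∂μ =
      ENNReal.ofReal (Real.exp (lam * (volume.real B * (Real.exp c - 1)))) := by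
  rw [hx.lintegral_comp_count hB hb hBS
    (φ := fun n => ENNReal.ofReal (Real.exp (c * n.toReal))) (by fun_prop)]
  simp_rw [ENNReal.toReal_natCast]
  rw [lintegral_exp_mul_poissonMeasure, NNReal.coe_mul, mul_assoc]
  rfl

lemma lintegral_exp_sum_mul_count (hx : IsHomogeneousPPPOn S lam x μ) {ι : Type*}
    (s : Finset ι) (B : ι → Set Plane) (hB : ∀ j ∈ s, MeasurableSet (B j))
    (hb : ∀ j ∈ s, Bornology.IsBounded (B j)) (hBS : ∀ j ∈ s, B j ⊆ S)
    (hd : (s : Set ι).PairwiseDisjoint B) (c : ι → ℝ) :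
    ∫⁻ ω, ENNReal.ofReal (Real.exp (∑ j ∈ s, c j * (countingMeasure x ω (B j)).toReal)) ∂μ =
      ENNReal.ofReal (Real.exp (lam * ∑ j ∈ s, volume.real (B j) * (Real.exp (c j) - 1))) := by
  -- `indep_count` speaks of families indexed by `Fin n`, hence the reindexing.
  set e := s.equivFin.symm
  have hsum : ∀ f : ι → ℝ, ∑ j ∈ s, f j = ∑ k, f (e k) := fun f => by
    rw [← Finset.sum_coe_sort, ← e.sum_comp]
  have hind := (hx.indep_count s.card (fun k => B (e k)) (fun k => hB _ (e k).2)
    (fun k => hb _ (e k).2) (fun k => hBS _ (e k).2)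
    (fun k l hkl => hd (e k).2 (e l).2 fun h => hkl (e.injective (Subtype.ext h)))).comp
    (fun k n => ENNReal.ofReal (Real.exp (c (e k) * n.toReal))) (fun k => by fun_prop)
  have hprod := lintegral_prod_eq_prod_lintegral_of_indepFun Finset.univ _ hind fun k =>
    Measurable.comp (by fun_prop) (measurable_countingMeasure hx.measurable (hB _ (e k).2))
  simp only [Function.comp_apply] at hprod
  simp_rw [hsum, Finset.mul_sum, Real.exp_sum]
  simp_rw [ENNReal.ofReal_prod_of_nonneg fun _ _ => (Real.exp_pos _).le]
  rw [hprod]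
  exact Finset.prod_congr rfl fun k _ =>
    hx.lintegral_exp_mul_count (hB _ (e k).2) (hb _ (e k).2) (hBS _ (e k).2) _

/-- The intensity measure of the points in the region `S`. -/
lemma sum_map_restrict (hx : IsHomogeneousPPPOn S lam x μ) (hS : MeasurableSet S) :
    (Measure.sum fun i => μ.map (x i)).restrict S = (lam : ℝ≥0∞) • volume.restrict S := by
  have key : ∀ B : Set Plane, MeasurableSet B → B ⊆ S → Bornology.IsBounded B →
      Measure.sum (fun i => μ.map (x i)) B = lam * volume B := fun B hB hBS hb => by
    rw [← hx.lintegral_count_of_isBounded hB hb hBS, Measure.sum_apply _ hB]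
    simp_rw [countingMeasure_apply x _ hB]
    rw [lintegral_tsum (f := fun i ω => B.indicator 1 (x i ω)) fun i =>
      ((measurable_one.indicator hB).comp (hx.measurable i)).aemeasurable]
    refine tsum_congr fun i => ?_
    rw [Measure.map_apply (hx.measurable i) hB, ← lintegral_indicator_one (hx.measurable i hB)]
    rfl
  ext B hB
  -- Counts are controlled on bounded sets only; balls exhaust the rest.
  have hU : B ∩ S = ⋃ n : ℕ, B ∩ S ∩ Metric.closedBall 0 n := by
    rw [← inter_iUnion, Metric.iUnion_closedBall_nat, inter_univ]
  have hmono : Monotone fun n : ℕ => B ∩ S ∩ Metric.closedBall (0 : Plane) n :=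
    fun m n h => inter_subset_inter_right _ (Metric.closedBall_subset_closedBall (by exact_mod_cast h))
  rw [Measure.smul_apply, Measure.restrict_apply hB, Measure.restrict_apply hB, hU,
    hmono.measure_iUnion, hmono.measure_iUnion, smul_eq_mul, ENNReal.mul_iSup]
  exact iSup_congr fun n => key _ ((hB.inter hS).inter Metric.isClosed_closedBall.measurableSet)
    (inter_subset_left.trans inter_subset_right) (Metric.isBounded_closedBall.subset inter_subset_right)

end IsHomogeneousPPPOn

end PoissonCounts

/-! ### Laplace functional of the unmarked process -/

section LaplaceFunctional

open Filter Topology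

/-- The value `0` is left out because its level set is in general unbounded and may leave `S`, where
nothing is known about the counts. -/
lemma simpleFunc_apply_eq_sum_indicator {α : Type*} [MeasurableSpace α] (s : SimpleFunc α ℝ)
    {φ : ℝ → ℝ} (hφ : φ 0 = 0) (y : α) :
    φ (s y) = ∑ c ∈ s.range.filter (· ≠ 0), φ c * (s ⁻¹' {c}).indicator (fun _ => (1 : ℝ)) y := by
  classical
  by_cases h : s y = 0
  · rw [h, hφ]
    refine (Finset.sum_eq_zero fun c hc => ?_).symm
    have hc0 : c ≠ 0 := (Finset.mem_filter.1 hc).2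
    rw [indicator_of_notMem (by simp [h, hc0.symm]), mul_zero]
  · rw [Finset.sum_eq_single_of_mem (s y) (by simp [h])]
    · simp
    · intro c _ hc
      rw [indicator_of_notMem (by simpa using hc.symm), mul_zero]

variable {Ω : Type*} [MeasurableSpace Ω] {μ : Measure Ω} {S K : Set Plane} {lam : ℝ≥0}
  {x : ℕ → Ω → Plane}

/-- Supplies the dominating function `exp (C * N(K))`, integrable because `N(K)` is Poisson. The
bound on arbitrary finite sums serves both full sums, which are finite here, and partial sums. -/
lemma norm_tsum_le_mul_count {Ω : Type*} {x : ℕ → Ω → Plane} {ω : Ω} (hK : MeasurableSet K)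
    (hfin : countingMeasure x ω K < ∞) {u : ℕ → ℝ} {C : ℝ} (hC : ∀ i, |u i| ≤ C)
    (hu : ∀ i, x i ω ∉ K → u i = 0) (J : Finset ℕ) :
    |∑ i ∈ J, u i| ≤ C * (countingMeasure x ω K).toReal := by
  have hf := finite_setOf_mem_of_count_lt_top hK hfin
  rw [toReal_count_eq_sum hK (I := J ∪ hf.toFinset) fun i hi => by simp [hi], Finset.mul_sum]
  refine (Finset.abs_sum_le_sum_abs _ _).trans ?_
  have hC0 : 0 ≤ C := (abs_nonneg _).trans (hC 0)
  calc ∑ i ∈ J, |u i| ≤ ∑ i ∈ J, C * K.indicator (fun _ => (1 : ℝ)) (x i ω) :=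
        Finset.sum_le_sum fun i _ => by
          by_cases h : x i ω ∈ K
          · simpa [h] using hC i
          · simp [h, hu i h]
    _ ≤ _ := Finset.sum_le_sum_of_subset_of_nonneg Finset.subset_union_left fun i _ _ =>
        mul_nonneg hC0 (indicator_nonneg (fun _ _ => zero_le_one) _)

lemma tsum_eq_sum_of_count_lt_top {Ω : Type*} {x : ℕ → Ω → Plane} {ω : Ω} (hK : MeasurableSet K)
    (hfin : countingMeasure x ω K < ∞) {u : ℕ → ℝ} (hu : ∀ i, x i ω ∉ K → u i = 0) :
    ∑' i, u i = ∑ i ∈ (finite_setOf_mem_of_count_lt_top hK hfin).toFinset, u i :=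
  tsum_eq_sum fun i hi => hu i fun h => hi (by simpa using h)

lemma tsum_simpleFunc_eq_sum_count {Ω : Type*} {x : ℕ → Ω → Plane} {ω : Ω} (hK : MeasurableSet K)
    (hfin : countingMeasure x ω K < ∞) (s : SimpleFunc Plane ℝ) (hs : ∀ y ∉ K, s y = 0) :
    ∑' i, s (x i ω) =
      ∑ c ∈ s.range.filter (· ≠ 0), c * (countingMeasure x ω (s ⁻¹' {c})).toReal := by
  rw [tsum_eq_sum_of_count_lt_top hK hfin (fun i hi => hs _ hi), Finset.sum_congr rfl fun i _ =>
    simpleFunc_apply_eq_sum_indicator s (φ := fun c => c) rfl (x i ω), Finset.sum_comm]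
  refine Finset.sum_congr rfl fun c hc => ?_
  have hc0 : c ≠ 0 := (Finset.mem_filter.1 hc).2
  rw [← Finset.mul_sum, toReal_count_eq_sum (s.measurableSet_preimage _)]
  intro i hi
  simp only [Finite.mem_toFinset, mem_ofPred_eq]
  by_contra h
  exact hc0 ((hs _ h).symm.trans hi).symm

lemma sum_mul_volume_simpleFunc (hb : Bornology.IsBounded K)
    (s : SimpleFunc Plane ℝ) (hs : ∀ y ∉ K, s y = 0) :
    ∑ c ∈ s.range.filter (· ≠ 0), volume.real (s ⁻¹' {c}) * (Real.exp c - 1) =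
      ∫ y, (Real.exp (s y) - 1) := by
  simp_rw [simpleFunc_apply_eq_sum_indicator s (φ := fun c => Real.exp c - 1) (by simp)]
  have hsub : ∀ c ∈ s.range.filter (· ≠ 0), volume (s ⁻¹' {c}) < ∞ := fun c hc => by
    refine (measure_mono fun y hy => ?_).trans_lt hb.measure_lt_top
    by_contra h
    exact (Finset.mem_filter.1 hc).2 ((hs _ h).symm.trans hy).symm
  rw [integral_finsetSum _ fun c hc => Integrable.const_mul ((integrable_indicator_iff
    (s.measurableSet_preimage _)).2 (integrableOn_const (hsub c hc).ne)) _]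
  refine Finset.sum_congr rfl fun c hc => ?_
  rw [integral_const_mul, integral_indicator_const _ (s.measurableSet_preimage _), smul_eq_mul,
    mul_one, mul_comm]

namespace IsHomogeneousPPPOn

lemma lintegral_exp_tsum_simpleFunc (hx : IsHomogeneousPPPOn S lam x μ) (hK : MeasurableSet K)
    (hb : Bornology.IsBounded K) (hKS : K ⊆ S) (s : SimpleFunc Plane ℝ) (hs : ∀ y ∉ K, s y = 0) :
    ∫⁻ ω, ENNReal.ofReal (Real.exp (∑' i, s (x i ω))) ∂μ =
      ENNReal.ofReal (Real.exp (lam * ∫ y, (Real.exp (s y) - 1))) := by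
  have hsub : ∀ c ∈ s.range.filter (· ≠ 0), s ⁻¹' {c} ⊆ K := fun c hc y hy => by
    by_contra h
    exact (Finset.mem_filter.1 hc).2 ((hs _ h).symm.trans hy).symm
  rw [← sum_mul_volume_simpleFunc hb s hs, ← hx.lintegral_exp_sum_mul_count _ (fun c => s ⁻¹' {c})
    (fun c _ => s.measurableSet_preimage _) (fun c hc => hb.subset (hsub c hc))
    (fun c hc => (hsub c hc).trans hKS)
    (fun c _ d _ hcd => (disjoint_singleton.2 hcd).preimage s) fun c => c]
  refine lintegral_congr_ae ?_
  filter_upwards [hx.ae_count_lt_top hK hb hKS] with ω hω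
  rw [tsum_simpleFunc_eq_sum_count hK hω s hs]

lemma lintegral_exp_mul_count_lt_top (hx : IsHomogeneousPPPOn S lam x μ) (hK : MeasurableSet K)
    (hb : Bornology.IsBounded K) (hKS : K ⊆ S) (C : ℝ) :
    ∫⁻ ω, ENNReal.ofReal (Real.exp (C * (countingMeasure x ω K).toReal)) ∂μ ≠ ∞ := by
  rw [hx.lintegral_exp_mul_count hK hb hKS]
  exact ENNReal.ofReal_ne_top

/-- The Laplace functional of a Poisson point process, at a bounded function with bounded
support. -/
theorem lintegral_exp_tsum (hx : IsHomogeneousPPPOn S lam x μ) (hK : MeasurableSet K)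
    (hb : Bornology.IsBounded K) (hKS : K ⊆ S) {h : Plane → ℝ} (hm : Measurable h) {C : ℝ}
    (hC : ∀ y, |h y| ≤ C) (h0 : ∀ y ∉ K, h y = 0) :
    ∫⁻ ω, ENNReal.ofReal (Real.exp (∑' i, h (x i ω))) ∂μ =
      ENNReal.ofReal (Real.exp (lam * ∫ y, (Real.exp (h y) - 1))) := by
  have hC0 : 0 ≤ C := (abs_nonneg _).trans (hC 0)
  -- Simple approximations that keep both the bound `C` and the support in `K`, so that one
  -- dominating function serves all `n`.
  set s : ℕ → SimpleFunc Plane ℝ := fun n => (hm.stronglyMeasurable.approxBounded C n).restrict K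
  have hs0 : ∀ n, ∀ y ∉ K, s n y = 0 := fun n y hy => by
    simp [s, SimpleFunc.restrict_apply _ hK, hy]
  have hsC : ∀ n y, |s n y| ≤ C := fun n y => by
    by_cases hy : y ∈ K
    · simpa [s, SimpleFunc.restrict_apply _ hK, hy] using
        hm.stronglyMeasurable.norm_approxBounded_le hC0 n y
    · rwa [hs0 n y hy, abs_zero]
  have hst : ∀ y, Tendsto (fun n => s n y) atTop (𝓝 (h y)) := fun y => by
    by_cases hy : y ∈ K
    · simpa [s, SimpleFunc.restrict_apply _ hK, hy] using
        hm.stronglyMeasurable.tendsto_approxBounded_of_norm_le (hC y)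
    · simp [hs0 _ y hy, h0 y hy]
  have hfin := hx.ae_count_lt_top hK hb hKS
  have hleft : Tendsto (fun n => ∫⁻ ω, ENNReal.ofReal (Real.exp (∑' i, s n (x i ω))) ∂μ) atTop
      (𝓝 (∫⁻ ω, ENNReal.ofReal (Real.exp (∑' i, h (x i ω))) ∂μ)) := by
    refine tendsto_lintegral_of_dominated_convergence' _ (fun n => ?_) (fun n => ?_)
      (hx.lintegral_exp_mul_count_lt_top hK hb hKS C) ?_
    · have : AEMeasurable (fun ω => ∑' i, s n (x i ω)) μ := by
        refine AEMeasurable.congr (f := fun ω => ∑ c ∈ (s n).range.filter (· ≠ 0),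
          c * (countingMeasure x ω (s n ⁻¹' {c})).toReal) ?_ ?_
        · exact (Finset.measurable_fun_sum _ fun c _ => ((measurable_countingMeasure hx.measurable
            ((s n).measurableSet_preimage _)).ennreal_toReal.const_mul c)).aemeasurable
        · filter_upwards [hfin] with ω hω
          exact (tsum_simpleFunc_eq_sum_count hK hω (s n) (hs0 n)).symm
      fun_prop
    · filter_upwards [hfin] with ω hω
      rw [tsum_eq_sum_of_count_lt_top hK hω (fun i hi => hs0 n _ hi)]
      exact ENNReal.ofReal_le_ofReal (Real.exp_le_exp.2 ((le_abs_self _).trans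
        (norm_tsum_le_mul_count hK hω (fun i => hsC n _) (fun i hi => hs0 n _ hi) _)))
    · filter_upwards [hfin] with ω hω
      simp_rw [tsum_eq_sum_of_count_lt_top hK hω (fun i hi => hs0 _ _ hi),
        tsum_eq_sum_of_count_lt_top hK hω (fun i hi => h0 _ hi)]
      exact ENNReal.tendsto_ofReal ((Real.continuous_exp.tendsto _).comp
        (tendsto_finsetSum _ fun i _ => hst _))
  have hright : Tendsto (fun n => ∫ y, (Real.exp (s n y) - 1)) atTop
      (𝓝 (∫ y, (Real.exp (h y) - 1))) := by
    refine tendsto_integral_of_dominated_convergence (K.indicator fun _ => Real.exp C + 1)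
      (fun n => ?_) ?_ (fun n => ?_) ?_
    · exact ((Real.measurable_exp.comp (s n).measurable).sub_const 1).aestronglyMeasurable
    · exact (integrable_indicator_iff hK).2 (integrableOn_const hb.measure_lt_top.ne)
    · refine Eventually.of_forall fun y => ?_
      by_cases hy : y ∈ K
      · rw [indicator_of_mem hy]
        refine (norm_sub_le _ _).trans ?_
        simpa using (le_abs_self _).trans (hsC n y)
      · simp [hy, hs0 n y hy]
    · exact Eventually.of_forall fun y =>
        ((Real.continuous_exp.tendsto _).comp (hst y)).sub_const 1
  refine tendsto_nhds_unique hleft ?_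
  simp_rw [fun n => hx.lintegral_exp_tsum_simpleFunc hK hb hKS (s n) (hs0 n)]
  exact ENNReal.tendsto_ofReal ((Real.continuous_exp.tendsto _).comp (hright.const_mul _))

end IsHomogeneousPPPOn

end LaplaceFunctional

/-! ### Independent marks and Campbell's formula -/

section Marking

open Filter Topology

variable {Ω : Type*} [MeasurableSpace Ω] {μ : Measure Ω} {S K : Set Plane} {lam : ℝ≥0}
  {x : ℕ → Ω → Plane} {g : ℕ → Ω → ℝ} {ν : Measure ℝ}

lemma ProbabilityTheory.IndepFun.lintegral_comp_prod {E F : Type*} [MeasurableSpace E]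
    [MeasurableSpace F] [IsProbabilityMeasure μ] {X : Ω → E} {Y : Ω → F} (hX : Measurable X)
    (hY : Measurable Y) (h : IndepFun X Y μ) {φ : E × F → ℝ≥0∞} (hφ : Measurable φ) :
    ∫⁻ ω, φ (X ω, Y ω) ∂μ = ∫⁻ ω, ∫⁻ ω', φ (X ω, Y ω') ∂μ ∂μ := by
  rw [← lintegral_map (f := φ) hφ (hX.prodMk hY), h.map_prod_eq_prod_map_map hX.aemeasurable hY.aemeasurable,
    lintegral_prod _ hφ.aemeasurable, lintegral_map hφ.lintegral_prod_right' hX]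
  refine lintegral_congr fun ω => ?_
  rw [lintegral_map (by fun_prop) hY]

/-- With the points frozen, which Fubini permits because points and marks are independent, the
factors depend on distinct independent marks, so the expectation of the product factorises. -/
lemma lintegral_prod_marks [IsProbabilityMeasure μ] (hx : ∀ i, Measurable (x i))
    (hg : ∀ i, Measurable (g i)) (hν : ∀ i, μ.map (g i) = ν) (hi : iIndepFun g μ)
    (hxg : IndepFun (fun ω i => x i ω) (fun ω i => g i ω) μ) {ψ : Plane × ℝ → ℝ≥0∞}
    (hψ : Measurable ψ) (n : ℕ) :
    ∫⁻ ω, ∏ i ∈ Finset.range n, ψ (x i ω, g i ω) ∂μ =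
      ∫⁻ ω, ∏ i ∈ Finset.range n, ∫⁻ z, ψ (x i ω, z) ∂ν ∂μ := by
  rw [hxg.lintegral_comp_prod (φ := fun p => ∏ i ∈ Finset.range n, ψ (p.1 i, p.2 i))
    (measurable_pi_lambda _ hx) (measurable_pi_lambda _ hg) (by fun_prop)]
  refine lintegral_congr fun ω => ?_
  have h := lintegral_prod_eq_prod_lintegral_of_indepFun (Finset.range n) _
    (hi.comp (fun i z => ψ (x i ω, z)) fun i => by fun_prop)
    fun i => Measurable.comp (by fun_prop) (hg i)
  simp only [Function.comp_apply] at h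
  rw [h]
  refine Finset.prod_congr rfl fun i _ => ?_
  rw [← hν i, lintegral_map (by fun_prop) (hg i)]

/-- Independence of the marks handles finitely many indices at a time; this limit carries the result
to the full sum. -/
lemma IsHomogeneousPPPOn.tendsto_lintegral_exp_sum (hx : IsHomogeneousPPPOn S lam x μ)
    (hK : MeasurableSet K) (hb : Bornology.IsBounded K) (hKS : K ⊆ S) {u : ℕ → Ω → ℝ}
    (hu : ∀ i, Measurable (u i)) {C : ℝ} (hC : ∀ i ω, |u i ω| ≤ C)
    (h0 : ∀ i ω, x i ω ∉ K → u i ω = 0) :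
    Tendsto (fun n => ∫⁻ ω, ENNReal.ofReal (Real.exp (∑ i ∈ Finset.range n, u i ω)) ∂μ) atTop
      (𝓝 (∫⁻ ω, ENNReal.ofReal (Real.exp (∑' i, u i ω)) ∂μ)) := by
  have hfin := hx.ae_count_lt_top hK hb hKS
  refine tendsto_lintegral_of_dominated_convergence' _ (fun n => ?_) (fun n => ?_)
    (hx.lintegral_exp_mul_count_lt_top hK hb hKS C) ?_
  · exact (Finset.measurable_fun_sum (Finset.range n) fun i _ => hu i).exp.ennreal_ofReal.aemeasurable
  · filter_upwards [hfin] with ω hω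
    exact ENNReal.ofReal_le_ofReal (Real.exp_le_exp.2 ((le_abs_self _).trans
      (norm_tsum_le_mul_count hK hω (fun i => hC i _) (fun i hi => h0 i _ hi) _)))
  · filter_upwards [hfin] with ω hω
    have hs : Summable fun i => u i ω := summable_of_hasFiniteSupport
      ((finite_setOf_mem_of_count_lt_top hK hω).subset fun i hi => by
        by_contra h
        exact hi (h0 i ω h))
    exact ENNReal.tendsto_ofReal ((Real.continuous_exp.tendsto _).comp hs.hasSum.tendsto_sum_nat)

/-- The Laplace functional of an independently marked Poisson point process, at a bounded function
of the points and the marks that vanishes when the point is outside a bounded set. -/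
theorem IsHomogeneousPPPOn.lintegral_exp_tsum_marks [IsProbabilityMeasure μ]
    [IsProbabilityMeasure ν] (hx : IsHomogeneousPPPOn S lam x μ)
    (hg : ∀ i, Measurable (g i)) (hν : ∀ i, μ.map (g i) = ν) (hi : iIndepFun g μ)
    (hxg : IndepFun (fun ω i => x i ω) (fun ω i => g i ω) μ)
    (hK : MeasurableSet K) (hb : Bornology.IsBounded K) (hKS : K ⊆ S) {f : Plane × ℝ → ℝ}
    (hm : Measurable f) {C : ℝ} (hC : ∀ p, |f p| ≤ C) (h0 : ∀ y ∉ K, ∀ z, f (y, z) = 0) :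
    ∫⁻ ω, ENNReal.ofReal (Real.exp (∑' i, f (x i ω, g i ω))) ∂μ =
      ENNReal.ofReal (Real.exp (lam * ∫ y, ∫ z, (Real.exp (f (y, z)) - 1) ∂ν)) := by
  have hint : ∀ y, Integrable (fun z => Real.exp (f (y, z))) ν := fun y =>
    Integrable.of_bound (Measurable.aestronglyMeasurable (by fun_prop)) (Real.exp C) (Eventually.of_forall fun z => by
      simpa using (le_abs_self _).trans (hC (y, z)))
  set m : Plane → ℝ := fun y => ∫ z, Real.exp (f (y, z)) ∂ν with hm_def
  have hmm : Measurable m := by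
    have : Measurable fun p => Real.exp (f p) := by fun_prop
    exact this.stronglyMeasurable.integral_prod_right'.measurable
  have hlow : ∀ y, Real.exp (-C) ≤ m y := fun y => by
    have h := integral_mono (integrable_const (Real.exp (-C))) (hint y)
      fun z => Real.exp_le_exp.2 (neg_le_of_abs_le (hC (y, z)))
    simpa using h
  have hup : ∀ y, m y ≤ Real.exp C := fun y => by
    have h := integral_mono (hint y) (integrable_const (Real.exp C))
      fun z => Real.exp_le_exp.2 (le_of_abs_le (hC (y, z)))
    simpa using h
  have hpos : ∀ y, 0 < m y := fun y => (Real.exp_pos _).trans_le (hlow y)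
  have hlog0 : ∀ y ∉ K, Real.log (m y) = 0 := fun y hy => by simp [m, h0 y hy]
  have hlogC : ∀ y, |Real.log (m y)| ≤ C := fun y =>
    abs_le.2 ⟨(Real.le_log_iff_exp_le (hpos y)).2 (hlow y), (Real.log_le_iff_le_exp (hpos y)).2 (hup y)⟩
  -- Averaging over the mark of a point at `y` replaces `exp (f (y, z))` by `m y = exp (log (m y))`.
  -- As `log m` has the same bound `C` and vanishes off `K`, the unmarked formula applies to it.
  have hstep : ∀ n : ℕ,
      ∫⁻ ω, ENNReal.ofReal (Real.exp (∑ i ∈ Finset.range n, f (x i ω, g i ω))) ∂μ =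
        ∫⁻ ω, ENNReal.ofReal (Real.exp (∑ i ∈ Finset.range n, Real.log (m (x i ω)))) ∂μ := by
    intro n
    simp_rw [Real.exp_sum, ENNReal.ofReal_prod_of_nonneg fun _ _ => (Real.exp_pos _).le,
      Real.exp_log (hpos _)]
    rw [lintegral_prod_marks hx.measurable hg hν hi hxg
      (ψ := fun p => ENNReal.ofReal (Real.exp (f p))) (by fun_prop)]
    refine lintegral_congr fun ω => Finset.prod_congr rfl fun i _ => ?_
    rw [ofReal_integral_eq_lintegral_ofReal (hint _)
      (Eventually.of_forall fun z => (Real.exp_pos _).le)]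
  have h1 := hx.tendsto_lintegral_exp_sum hK hb hKS (u := fun i ω => f (x i ω, g i ω))
    (fun i => hm.comp ((hx.measurable i).prodMk (hg i))) (fun i ω => hC _)
    (fun i ω hω => h0 _ hω _)
  have h2 := hx.tendsto_lintegral_exp_sum hK hb hKS (u := fun i ω => Real.log (m (x i ω)))
    (fun i => (hmm.comp (hx.measurable i)).log) (fun i ω => hlogC _) (fun i ω hω => hlog0 _ hω)
  simp_rw [hstep] at h1
  rw [tendsto_nhds_unique h1 h2, hx.lintegral_exp_tsum hK hb hKS hmm.log hlogC hlog0]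
  simp_rw [Real.exp_log (hpos _), integral_sub (hint _) (integrable_const (1 : ℝ))]
  simp [m]

/-- Campbell's formula for an independently marked Poisson point process. -/
theorem IsHomogeneousPPPOn.lintegral_tsum_mul_marks [IsProbabilityMeasure μ]
    (hx : IsHomogeneousPPPOn S lam x μ) (hS : MeasurableSet S)
    (hg : ∀ i, Measurable (g i)) (hν : ∀ i, μ.map (g i) = ν)
    (hxg : IndepFun (fun ω i => x i ω) (fun ω i => g i ω) μ) {p : Plane → ℝ≥0∞}
    (hp : Measurable p) (hpS : ∀ y ∉ S, p y = 0) {q : ℝ → ℝ≥0∞} (hq : Measurable q) :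
    ∫⁻ ω, ∑' i, p (x i ω) * q (g i ω) ∂μ = lam * (∫⁻ y in S, p y) * ∫⁻ z, q z ∂ν := by
  have hind : ∀ i, IndepFun (fun ω => p (x i ω)) (fun ω => q (g i ω)) μ := fun i =>
    IndepFun.comp (φ := fun y : ℕ → Plane => p (y i)) (ψ := fun z : ℕ → ℝ => q (z i)) hxg
      (by fun_prop) (by fun_prop)
  have hpx : ∀ i, Measurable fun ω => p (x i ω) := fun i => hp.comp (hx.measurable i)
  have hqg : ∀ i, Measurable fun ω => q (g i ω) := fun i => hq.comp (hg i)
  rw [lintegral_tsum (f := fun i ω => p (x i ω) * q (g i ω)) fun i => ((hpx i).mul (hqg i)).aemeasurable]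
  have : ∀ i, ∫⁻ ω, p (x i ω) * q (g i ω) ∂μ = (∫⁻ y, p y ∂μ.map (x i)) * ∫⁻ z, q z ∂ν := fun i => by
    rw [lintegral_mul_eq_lintegral_mul_lintegral_of_indepFun'' (hpx i).aemeasurable
      (hqg i).aemeasurable (hind i), ← hν i, lintegral_map hq (hg i), lintegral_map hp (hx.measurable i)]
  simp_rw [this]
  have hpi : S.indicator p = p := indicator_eq_self.2 fun y hy => by
    by_contra h
    exact hy (hpS y h)
  rw [ENNReal.tsum_mul_right, ← lintegral_sum_measure, ← smul_eq_mul (lam : ℝ≥0∞),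
    ← lintegral_smul_measure, ← hx.sum_map_restrict hS, ← lintegral_indicator hS, hpi]

end Marking

/-! ### Removal of the truncation -/

section ExponentialMoments

open Filter Topology

/-- Truncation of a function of points and marks, to a bounded function that vanishes when the
point is far away. -/
noncomputable def localTrunc (φ : Plane × ℝ → ℝ) (n : ℕ) (p : Plane × ℝ) : ℝ :=
  if ‖p.1‖ ≤ n then min (φ p) n else 0

section Truncation

variable {φ : Plane × ℝ → ℝ}

lemma measurable_localTrunc (hφ : Measurable φ) (n : ℕ) : Measurable (localTrunc φ n) :=
  Measurable.ite (measurableSet_le (by fun_prop) measurable_const) (hφ.min measurable_const)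
    measurable_const

lemma localTrunc_nonneg (h0 : 0 ≤ φ) (n : ℕ) (p : Plane × ℝ) : 0 ≤ localTrunc φ n p := by
  unfold localTrunc
  split_ifs
  exacts [le_min (h0 p) n.cast_nonneg, le_rfl]

lemma localTrunc_le (h0 : 0 ≤ φ) (n : ℕ) (p : Plane × ℝ) : localTrunc φ n p ≤ φ p := by
  unfold localTrunc
  split_ifs
  exacts [min_le_left _ _, h0 p]

lemma localTrunc_le_natCast (n : ℕ) (p : Plane × ℝ) : localTrunc φ n p ≤ n := by
  unfold localTrunc
  split_ifs
  exacts [min_le_right _ _, n.cast_nonneg]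

lemma localTrunc_zero (h0 : 0 ≤ φ) (p : Plane × ℝ) : localTrunc φ 0 p = 0 :=
  le_antisymm (by simpa using localTrunc_le_natCast (φ := φ) 0 p) (localTrunc_nonneg h0 0 p)

lemma localTrunc_mono (h0 : 0 ≤ φ) (p : Plane × ℝ) : Monotone fun n => localTrunc φ n p := by
  intro m n hmn
  have hc : (m : ℝ) ≤ n := by exact_mod_cast hmn
  by_cases h : ‖p.1‖ ≤ m
  · simp only [localTrunc, h, h.trans hc, if_true]
    exact min_le_min_left _ hc
  · simp only [localTrunc, h, if_false]
    exact localTrunc_nonneg h0 n p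

lemma tendsto_localTrunc (φ : Plane × ℝ → ℝ) (p : Plane × ℝ) :
    Tendsto (fun n => localTrunc φ n p) atTop (𝓝 (φ p)) := by
  obtain ⟨N, hN⟩ := exists_nat_ge (max ‖p.1‖ (φ p))
  refine tendsto_const_nhds.congr' (EventuallyEq.symm ?_)
  filter_upwards [eventually_ge_atTop N] with n hn
  have hc : (N : ℝ) ≤ n := by exact_mod_cast hn
  rw [localTrunc, if_pos ((le_max_left _ _).trans (hN.trans hc)),
    min_eq_left ((le_max_right _ _).trans (hN.trans hc))]

lemma localTrunc_eq_zero {n : ℕ} {p : Plane × ℝ}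
    (h : φ p = 0 ∨ p.1 ∉ Metric.closedBall (0 : Plane) n) : localTrunc φ n p = 0 := by
  rcases h with h | h
  · simp [localTrunc, h]
  · rw [localTrunc, if_neg (by simpa using h)]

/-- The truncation takes values in `[0, n]`, where `F` is bounded, and `F 0 = 0` confines the
integrand to a set of finite measure. -/
lemma integrable_comp_localTrunc {ν : Measure ℝ} [IsProbabilityMeasure ν] (hφ : Measurable φ)
    (h0 : 0 ≤ φ) (n : ℕ) {F : ℝ → ℝ} (hF : Continuous F) (hF0 : F 0 = 0) :
    Integrable (fun p => F (localTrunc φ n p)) (volume.prod ν) := by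
  obtain ⟨C, hC⟩ := (isCompact_Icc (a := (0 : ℝ)) (b := n)).exists_bound_of_continuousOn
    hF.continuousOn
  have hK : MeasurableSet (Metric.closedBall (0 : Plane) n ×ˢ (univ : Set ℝ)) :=
    Metric.isClosed_closedBall.measurableSet.prod MeasurableSet.univ
  refine Integrable.mono' (g := (Metric.closedBall (0 : Plane) n ×ˢ (univ : Set ℝ)).indicator
    fun _ => C) ?_ (hF.measurable.comp (measurable_localTrunc hφ n)).aestronglyMeasurable
    (Eventually.of_forall fun p => ?_)
  · refine (integrable_indicator_iff hK).2 (integrableOn_const ?_)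
    rw [Measure.prod_prod]
    exact ENNReal.mul_ne_top measure_closedBall_lt_top.ne (measure_ne_top _ _)
  · by_cases hp : p.1 ∈ Metric.closedBall (0 : Plane) n
    · rw [indicator_of_mem (by simpa using hp)]
      exact hC _ ⟨localTrunc_nonneg h0 n p, localTrunc_le_natCast n p⟩
    · rw [localTrunc_eq_zero (Or.inr hp), hF0, norm_zero, indicator_of_notMem (by simpa using hp)]

lemma tendsto_lintegral_comp_localTrunc (ν : Measure ℝ) (hφ : Measurable φ) (h0 : 0 ≤ φ)
    {F : ℝ → ℝ} (hF : Continuous F) (hFm : Monotone F) :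
    Tendsto (fun n => ∫⁻ p, ENNReal.ofReal (F (localTrunc φ n p)) ∂volume.prod ν) atTop
      (𝓝 (∫⁻ p, ENNReal.ofReal (F (φ p)) ∂volume.prod ν)) := by
  refine lintegral_tendsto_of_tendsto_of_monotone (fun n => ?_) ?_ ?_
  · exact (hF.measurable.comp (measurable_localTrunc hφ n)).ennreal_ofReal.aemeasurable
  · exact Eventually.of_forall fun p m n hmn =>
      ENNReal.ofReal_le_ofReal (hFm (localTrunc_mono h0 p hmn))
  · exact Eventually.of_forall fun p =>
      ENNReal.tendsto_ofReal ((hF.tendsto _).comp (tendsto_localTrunc φ p))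

lemma tendsto_tsum_localTrunc (h0 : 0 ≤ φ) {w : ℕ → Plane × ℝ} (hs : Summable fun i => φ (w i)) :
    Tendsto (fun n => ∑' i, localTrunc φ n (w i)) atTop (𝓝 (∑' i, φ (w i))) :=
  tendsto_tsum_of_dominated_convergence hs (fun i => tendsto_localTrunc φ (w i))
    (Eventually.of_forall fun n i => by
      rw [Real.norm_of_nonneg (localTrunc_nonneg h0 n _)]
      exact localTrunc_le h0 n _)

lemma summable_localTrunc (h0 : 0 ≤ φ) {w : ℕ → Plane × ℝ} (hs : Summable fun i => φ (w i))
    (n : ℕ) : Summable fun i => localTrunc φ n (w i) :=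
  hs.of_nonneg_of_le (fun _ => localTrunc_nonneg h0 n _) fun _ => localTrunc_le h0 n _

end Truncation

lemma aemeasurable_tsum_of_summable {Ω : Type*} [MeasurableSpace Ω] {μ : Measure Ω}
    {u : ℕ → Ω → ℝ} (hu : ∀ i, AEMeasurable (u i) μ) (hs : ∀ᵐ ω ∂μ, Summable fun i => u i ω) :
    AEMeasurable (fun ω => ∑' i, u i ω) μ := by
  refine aemeasurable_of_tendsto_metrizable_ae atTop
    (f := fun n ω => ∑ i ∈ Finset.range n, u i ω)
    (fun n => Finset.aemeasurable_fun_sum _ fun i _ => hu i) ?_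
  filter_upwards [hs] with ω hω using hω.hasSum.tendsto_sum_nat

variable {Ω : Type*} [MeasurableSpace Ω] {μ : Measure Ω} {S A B : Set Plane} {lam : ℝ≥0}
  {x : ℕ → Ω → Plane} {g : ℕ → Ω → ℝ} {ν : Measure ℝ} {φ ψ : Plane × ℝ → ℝ}

/-- As `φ` or `ψ` vanishes at each point, `e^{φ-ψ} - 1 = (e^φ - 1) - (1 - e^{-ψ})` also for the
truncations. The levels `n` and `m` are separate because the two limits are taken one after the
other. -/
theorem IsHomogeneousPPPOn.lintegral_exp_tsum_localTrunc [IsProbabilityMeasure μ]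
    [IsProbabilityMeasure ν] (hx : IsHomogeneousPPPOn S lam x μ) (hS : MeasurableSet S)
    (hg : ∀ i, Measurable (g i)) (hν : ∀ i, μ.map (g i) = ν) (hi : iIndepFun g μ)
    (hxg : IndepFun (fun ω i => x i ω) (fun ω i => g i ω) μ)
    (hφ : Measurable φ) (hψ : Measurable ψ) (hφ0 : 0 ≤ φ) (hψ0 : 0 ≤ ψ)
    (hφS : ∀ y ∉ S, ∀ z, φ (y, z) = 0) (hψS : ∀ y ∉ S, ∀ z, ψ (y, z) = 0)
    (hd : ∀ p, φ p = 0 ∨ ψ p = 0) (n m : ℕ) :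
    ∫⁻ ω, ENNReal.ofReal (Real.exp
        (∑' i, (localTrunc φ n (x i ω, g i ω) - localTrunc ψ m (x i ω, g i ω)))) ∂μ =
      ENNReal.ofReal (Real.exp (lam *
        ((∫⁻ p, ENNReal.ofReal (Real.exp (localTrunc φ n p) - 1) ∂volume.prod ν).toReal -
          (∫⁻ p, ENNReal.ofReal (1 - Real.exp (-localTrunc ψ m p)) ∂volume.prod ν).toReal))) := by
  have hI₁ : Integrable (fun p => Real.exp (localTrunc φ n p) - 1) (volume.prod ν) :=
    integrable_comp_localTrunc hφ hφ0 n (F := fun r => Real.exp r - 1) (by fun_prop) (by simp)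
  have hI₂ : Integrable (fun p => 1 - Real.exp (-localTrunc ψ m p)) (volume.prod ν) :=
    integrable_comp_localTrunc hψ hψ0 m (F := fun r => 1 - Real.exp (-r)) (by fun_prop) (by simp)
  have hsplit : ∀ p, Real.exp (localTrunc φ n p - localTrunc ψ m p) - 1 =
      (Real.exp (localTrunc φ n p) - 1) - (1 - Real.exp (-localTrunc ψ m p)) := fun p => by
    rcases hd p with h | h
    · simp [localTrunc_eq_zero (φ := φ) (Or.inl h)]
    · simp [localTrunc_eq_zero (φ := ψ) (Or.inl h)]
  -- The radius `n + m` exceeds both truncation radii.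
  set K : Set Plane := S ∩ Metric.closedBall 0 (n + m : ℕ)
  have hK0 : ∀ y ∉ K, ∀ z, localTrunc φ n (y, z) - localTrunc ψ m (y, z) = 0 := fun y hy z => by
    by_cases hyS : y ∈ S
    · have hyn : ¬ ‖y‖ ≤ (n + m : ℕ) := fun h => hy ⟨hyS, by simpa using h⟩
      push_cast at hyn
      rw [localTrunc_eq_zero, localTrunc_eq_zero, sub_zero]
      · refine Or.inr fun h => hyn ((mem_closedBall_zero_iff.1 h).trans ?_)
        simp
      · refine Or.inr fun h => hyn ((mem_closedBall_zero_iff.1 h).trans ?_)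
        simp
    · rw [localTrunc_eq_zero (Or.inl (hφS y hyS z)), localTrunc_eq_zero (Or.inl (hψS y hyS z)),
        sub_zero]
  rw [hx.lintegral_exp_tsum_marks hg hν hi hxg (K := K)
    (hS.inter Metric.isClosed_closedBall.measurableSet)
    (Metric.isBounded_closedBall.subset inter_subset_right) inter_subset_left
    (f := fun p => localTrunc φ n p - localTrunc ψ m p) (C := n + m)
    ((measurable_localTrunc hφ n).sub (measurable_localTrunc hψ m)) (fun p => ?_) hK0]
  · simp_rw [hsplit]
    rw [← integral_prod (fun p => (Real.exp (localTrunc φ n p) - 1) -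
        (1 - Real.exp (-localTrunc ψ m p))) (hI₁.sub hI₂),
      integral_sub hI₁ hI₂, integral_eq_lintegral_of_nonneg_ae, integral_eq_lintegral_of_nonneg_ae]
    · exact Eventually.of_forall fun p => by simpa using localTrunc_nonneg hψ0 m p
    · exact hI₂.aestronglyMeasurable
    · exact Eventually.of_forall fun p => by simpa using localTrunc_nonneg hφ0 n p
    · exact hI₁.aestronglyMeasurable
  · rw [abs_le]
    have h₁ := localTrunc_nonneg hφ0 n p
    have h₂ := localTrunc_nonneg hψ0 m p
    have h₃ := localTrunc_le_natCast (φ := φ) n p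
    have h₄ := localTrunc_le_natCast (φ := ψ) m p
    constructor <;> linarith

/-- The exponential moment of a difference of two sums over disjoint parts of an independently
marked Poisson point process. -/
theorem IsHomogeneousPPPOn.tendsto_lintegral_exp_tsum_sub_tsum [IsProbabilityMeasure μ]
    [IsProbabilityMeasure ν] (hx : IsHomogeneousPPPOn S lam x μ) (hS : MeasurableSet S)
    (hg : ∀ i, Measurable (g i)) (hν : ∀ i, μ.map (g i) = ν) (hi : iIndepFun g μ)
    (hxg : IndepFun (fun ω i => x i ω) (fun ω i => g i ω) μ)
    (hφ : Measurable φ) (hψ : Measurable ψ) (hφ0 : 0 ≤ φ) (hψ0 : 0 ≤ ψ)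
    (hφS : ∀ y ∉ S, ∀ z, φ (y, z) = 0) (hψS : ∀ y ∉ S, ∀ z, ψ (y, z) = 0)
    (hd : ∀ p, φ p = 0 ∨ ψ p = 0)
    (hφs : ∀ᵐ ω ∂μ, Summable fun i => φ (x i ω, g i ω))
    (hψs : ∀ᵐ ω ∂μ, Summable fun i => ψ (x i ω, g i ω))
    (hV : ∫⁻ p, ENNReal.ofReal (1 - Real.exp (-ψ p)) ∂volume.prod ν ≠ ∞) :
    Tendsto (fun n => ENNReal.ofReal (Real.exp (lam *
        ((∫⁻ p, ENNReal.ofReal (Real.exp (localTrunc φ n p) - 1) ∂volume.prod ν).toReal -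
          (∫⁻ p, ENNReal.ofReal (1 - Real.exp (-ψ p)) ∂volume.prod ν).toReal)))) atTop
      (𝓝 (∫⁻ ω, ENNReal.ofReal (Real.exp
        (∑' i, φ (x i ω, g i ω) - ∑' i, ψ (x i ω, g i ω))) ∂μ)) := by
  have hw : ∀ i, Measurable fun ω => (x i ω, g i ω) := fun i => (hx.measurable i).prodMk (hg i)
  have hφsm : ∀ n, AEMeasurable (fun ω => ∑' i, localTrunc φ n (x i ω, g i ω)) μ := fun n =>
    aemeasurable_tsum_of_summable
      (fun i => ((measurable_localTrunc hφ n).comp (hw i)).aemeasurable)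
      (hφs.mono fun ω h => summable_localTrunc hφ0 h n)
  have hψtm : ∀ n, AEMeasurable (fun ω => ∑' i, localTrunc ψ n (x i ω, g i ω)) μ := fun n =>
    aemeasurable_tsum_of_summable
      (fun i => ((measurable_localTrunc hψ n).comp (hw i)).aemeasurable)
      (hψs.mono fun ω h => summable_localTrunc hψ0 h n)
  have hψm : AEMeasurable (fun ω => ∑' i, ψ (x i ω, g i ω)) μ :=
    aemeasurable_tsum_of_summable (fun i => (hψ.comp (hw i)).aemeasurable) hψs
  have hmain : ∀ n m, ∫⁻ ω, ENNReal.ofReal (Real.exp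
      (∑' i, localTrunc φ n (x i ω, g i ω) - ∑' i, localTrunc ψ m (x i ω, g i ω))) ∂μ =
      ENNReal.ofReal (Real.exp (lam *
        ((∫⁻ p, ENNReal.ofReal (Real.exp (localTrunc φ n p) - 1) ∂volume.prod ν).toReal -
          (∫⁻ p, ENNReal.ofReal (1 - Real.exp (-localTrunc ψ m p)) ∂volume.prod ν).toReal))) :=
    fun n m => by
    rw [← hx.lintegral_exp_tsum_localTrunc hS hg hν hi hxg hφ hψ hφ0 hψ0 hφS hψS hd]
    refine lintegral_congr_ae ?_
    filter_upwards [hφs, hψs] with ω h₁ h₂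
    rw [(summable_localTrunc hφ0 h₁ n).tsum_sub (summable_localTrunc hψ0 h₂ m)]
  have hlim : ∀ n, ∫⁻ ω, ENNReal.ofReal (Real.exp
      (∑' i, localTrunc φ n (x i ω, g i ω) - ∑' i, ψ (x i ω, g i ω))) ∂μ =
      ENNReal.ofReal (Real.exp (lam *
        ((∫⁻ p, ENNReal.ofReal (Real.exp (localTrunc φ n p) - 1) ∂volume.prod ν).toReal -
          (∫⁻ p, ENNReal.ofReal (1 - Real.exp (-ψ p)) ∂volume.prod ν).toReal))) := fun n => by
    have hright := tendsto_lintegral_comp_localTrunc ν hψ hψ0 (F := fun r => 1 - Real.exp (-r))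
      (by fun_prop) (fun a b hab => sub_le_sub_left (Real.exp_le_exp.2 (neg_le_neg hab)) 1)
    have hR := ENNReal.tendsto_ofReal ((Real.continuous_exp.tendsto _).comp
      ((((ENNReal.tendsto_toReal hV).comp hright).const_sub
        (∫⁻ p, ENNReal.ofReal (Real.exp (localTrunc φ n p) - 1) ∂volume.prod ν).toReal).const_mul
          (lam : ℝ)))
    refine tendsto_nhds_unique ?_ hR
    simp only [Function.comp_def, ← hmain]
    refine tendsto_lintegral_of_dominated_convergence'
      (fun ω => ENNReal.ofReal (Real.exp (∑' i, localTrunc φ n (x i ω, g i ω)))) (fun m => ?_)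
      (fun m => ?_) ?_ ?_
    · exact ((hφsm n).sub (hψtm m)).exp.ennreal_ofReal
    · exact Eventually.of_forall fun ω => ENNReal.ofReal_le_ofReal (Real.exp_le_exp.2
        (sub_le_self _ (tsum_nonneg fun i => localTrunc_nonneg hψ0 m _)))
    -- Truncation of `ψ` at level `0` is zero, so this instance is the exponential moment of the
    -- dominating function.
    · have h := hmain n 0
      simp only [localTrunc_zero hψ0, tsum_zero, sub_zero] at h
      rw [h]
      exact ENNReal.ofReal_ne_top
    · filter_upwards [hψs] with ω hω
      exact ENNReal.tendsto_ofReal ((Real.continuous_exp.tendsto _).comp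
        ((tendsto_tsum_localTrunc hψ0 hω).const_sub _))
  simp_rw [← hlim]
  -- Then `n → ∞` by monotone convergence, which needs no finiteness.
  refine lintegral_tendsto_of_tendsto_of_monotone (fun n => ?_) ?_ ?_
  · exact ((hφsm n).sub hψm).exp.ennreal_ofReal
  · filter_upwards [hφs] with ω hω m n hmn
    exact ENNReal.ofReal_le_ofReal (Real.exp_le_exp.2 (sub_le_sub_right
      ((summable_localTrunc hφ0 hω m).tsum_le_tsum (fun i => localTrunc_mono hφ0 _ hmn)
        (summable_localTrunc hφ0 hω n)) _))
  · filter_upwards [hφs] with ω hω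
    exact ENNReal.tendsto_ofReal ((Real.continuous_exp.tendsto _).comp
      ((tendsto_tsum_localTrunc hφ0 hω).sub_const _))

/-- If `∫ (e^φ - 1)` is finite, the truncated formula passes to the limit by continuity. If it is
infinite, the truncated integrals are finite and tend to infinity; since `λ > 0` and the `ψ`
integral is finite, the exponent diverges too. -/
theorem IsHomogeneousPPPOn.lintegral_exp_tsum_sub_tsum [IsProbabilityMeasure μ]
    [IsProbabilityMeasure ν] (hx : IsHomogeneousPPPOn S lam x μ) (hlam : 0 < lam)
    (hS : MeasurableSet S)
    (hg : ∀ i, Measurable (g i)) (hν : ∀ i, μ.map (g i) = ν) (hi : iIndepFun g μ)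
    (hxg : IndepFun (fun ω i => x i ω) (fun ω i => g i ω) μ)
    (hφ : Measurable φ) (hψ : Measurable ψ) (hφ0 : 0 ≤ φ) (hψ0 : 0 ≤ ψ)
    (hφS : ∀ y ∉ S, ∀ z, φ (y, z) = 0) (hψS : ∀ y ∉ S, ∀ z, ψ (y, z) = 0)
    (hd : ∀ p, φ p = 0 ∨ ψ p = 0)
    (hφs : ∀ᵐ ω ∂μ, Summable fun i => φ (x i ω, g i ω))
    (hψs : ∀ᵐ ω ∂μ, Summable fun i => ψ (x i ω, g i ω))
    (hV : ∫⁻ p, ENNReal.ofReal (1 - Real.exp (-ψ p)) ∂volume.prod ν ≠ ∞) :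
    (∫⁻ ω, ENNReal.ofReal (Real.exp (∑' i, φ (x i ω, g i ω) - ∑' i, ψ (x i ω, g i ω))) ∂μ ≠ ∞ ↔
      ∫⁻ p, ENNReal.ofReal (Real.exp (φ p) - 1) ∂volume.prod ν ≠ ∞) ∧
    (∫⁻ p, ENNReal.ofReal (Real.exp (φ p) - 1) ∂volume.prod ν ≠ ∞ →
      ∫⁻ ω, ENNReal.ofReal (Real.exp (∑' i, φ (x i ω, g i ω) - ∑' i, ψ (x i ω, g i ω))) ∂μ =
        ENNReal.ofReal (Real.exp (lam *
          ((∫⁻ p, ENNReal.ofReal (Real.exp (φ p) - 1) ∂volume.prod ν).toReal -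
            (∫⁻ p, ENNReal.ofReal (1 - Real.exp (-ψ p)) ∂volume.prod ν).toReal)))) := by
  have hlim := hx.tendsto_lintegral_exp_tsum_sub_tsum hS hg hν hi hxg hφ hψ hφ0 hψ0 hφS hψS hd
    hφs hψs hV
  have hU := tendsto_lintegral_comp_localTrunc ν hφ hφ0 (F := fun r => Real.exp r - 1)
    (by fun_prop) (fun a b hab => by simpa using hab)
  have hval : ∫⁻ p, ENNReal.ofReal (Real.exp (φ p) - 1) ∂volume.prod ν ≠ ∞ →
      ∫⁻ ω, ENNReal.ofReal (Real.exp (∑' i, φ (x i ω, g i ω) - ∑' i, ψ (x i ω, g i ω))) ∂μ =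
        ENNReal.ofReal (Real.exp (lam *
          ((∫⁻ p, ENNReal.ofReal (Real.exp (φ p) - 1) ∂volume.prod ν).toReal -
            (∫⁻ p, ENNReal.ofReal (1 - Real.exp (-ψ p)) ∂volume.prod ν).toReal))) := fun h =>
    tendsto_nhds_unique hlim (ENNReal.tendsto_ofReal ((Real.continuous_exp.tendsto _).comp
      ((((ENNReal.tendsto_toReal h).comp hU).sub_const _).const_mul (lam : ℝ))))
  refine ⟨⟨fun h htop => h ?_, fun h => by rw [hval h]; exact ENNReal.ofReal_ne_top⟩, hval⟩
  refine tendsto_nhds_unique hlim (ENNReal.tendsto_ofReal_nhds_top.2 ?_)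
  have hne : ∀ n, ∫⁻ p, ENNReal.ofReal (Real.exp (localTrunc φ n p) - 1) ∂volume.prod ν ≠ ∞ :=
    fun n => (integrable_comp_localTrunc hφ hφ0 n (F := fun r => Real.exp r - 1)
      (by fun_prop) (by simp)).lintegral_lt_top.ne
  have hat : Tendsto (fun n => (∫⁻ p, ENNReal.ofReal (Real.exp (localTrunc φ n p) - 1)
      ∂volume.prod ν).toReal) atTop atTop := by
    rw [← ENNReal.tendsto_ofReal_nhds_top]
    simp_rw [ENNReal.ofReal_toReal (hne _)]
    rwa [htop] at hU
  exact Real.tendsto_exp_atTop.comp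
    ((tendsto_atTop_add_const_right _ _ hat).const_mul_atTop (NNReal.coe_pos.2 hlam))

end ExponentialMoments

/-! ### Polar coordinates in the plane -/

section Polar

open Filter Topology

/-- Integration of radial functions over the plane. -/
lemma lintegral_fun_norm_plane {F : ℝ → ℝ≥0∞} (hF : Measurable F) :
    ∫⁻ y : Plane, F ‖y‖ =
      ENNReal.ofReal (2 * Real.pi) * ∫⁻ r in Ioi (0 : ℝ), ENNReal.ofReal r * F r := by
  -- The length of the unit circle is the dimension `2` times the area `π` of the unit disc.
  have hsphere : (volume : Measure Plane).toSphere univ = ENNReal.ofReal (2 * Real.pi) := by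
    rw [Measure.toSphere_apply_univ, EuclideanSpace.volume_ball_fin_two,
      finrank_euclideanSpace_fin]
    rw [ENNReal.ofReal_mul two_pos.le]
    simp [← NNReal.coe_real_pi]
  have h := (volume : Measure Plane).measurePreserving_homeomorphUnitSphereProd.lintegral_comp
    (f := fun p => F p.2) (by fun_prop)
  simp only [homeomorphUnitSphereProd_apply_snd_coe] at h
  have hdim : Module.finrank ℝ Plane - 1 = 1 := by rw [finrank_euclideanSpace_fin]
  calc ∫⁻ y : Plane, F ‖y‖ = ∫⁻ y in ({0}ᶜ : Set Plane), F ‖y‖ := by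
        rw [restrict_compl_singleton]
    _ = ∫⁻ y : ({0}ᶜ : Set Plane), F ‖(y : Plane)‖ ∂(volume.comap Subtype.val) :=
        (lintegral_subtype_comap (measurableSet_singleton (0 : Plane)).compl fun y => F ‖y‖).symm
    _ = _ := by
        rw [h, hdim, lintegral_prod _ (by fun_prop)]
        simp only
        rw [lintegral_const, hsphere, mul_comm,
          Measure.volumeIoiPow, lintegral_withDensity_eq_lintegral_mul _ (by fun_prop)
            (by fun_prop)]
        simp only [Pi.mul_apply, pow_one]
        rw [lintegral_subtype_comap measurableSet_Ioi fun r : ℝ => ENNReal.ofReal r * F r]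

end Polar

/-! ### Radial path loss: integrability and reduction to integrals over the radius -/

section RadialSums

open Filter Topology

/-- The power received from a transmitter at the point `p.1` with channel gain `p.2`, if the
distance of the point from the origin lies in `J`. -/
noncomputable def radialPower (c α : ℝ) (J : Set ℝ) (p : Plane × ℝ) : ℝ :=
  J.indicator (fun r => c * r ^ (-α)) ‖p.1‖ * |p.2|

variable {ν : Measure ℝ} {c s α a : ℝ} {I J : Set ℝ}

lemma measurable_indicator_rpow (hJ : MeasurableSet J) :
    Measurable (J.indicator fun r : ℝ => c * r ^ (-α)) :=
  Measurable.indicator (by fun_prop) hJ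

lemma measurable_radialPower (hJ : MeasurableSet J) : Measurable (radialPower c α J) := by
  have := measurable_indicator_rpow (c := c) (α := α) hJ
  unfold radialPower
  fun_prop

lemma indicator_rpow_nonneg (hc : 0 ≤ c) (hJ0 : J ⊆ Ioi 0) (r : ℝ) :
    0 ≤ J.indicator (fun r => c * r ^ (-α)) r :=
  indicator_nonneg (fun _ hr => mul_nonneg hc (Real.rpow_nonneg (hJ0 hr).le _)) r

lemma radialPower_nonneg (hc : 0 ≤ c) (hJ0 : J ⊆ Ioi 0) : 0 ≤ radialPower c α J := fun _ =>
  mul_nonneg (indicator_rpow_nonneg hc hJ0 _) (abs_nonneg _)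

/-- `J` is the half-open or closed range of radii of the stations, `I` the open interval of the
final formula; they differ by a null set. Since `F 0 = 0`, radii outside `J` contribute nothing. -/
lemma lintegral_comp_radialPower [SFinite ν] (hJ : MeasurableSet J) (hJ0 : J ⊆ Ioi 0)
    (hIJ : J =ᵐ[volume] I) {F : ℝ → ℝ} (hF : Measurable F) (hF0 : F 0 = 0) :
    ∫⁻ p, ENNReal.ofReal (F (radialPower c α J p)) ∂volume.prod ν =
      ENNReal.ofReal (2 * Real.pi) * ∫⁻ r in I, ENNReal.ofReal r *
        ∫⁻ z, ENNReal.ofReal (F (c * r ^ (-α) * |z|)) ∂ν := by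
  have hm := measurable_indicator_rpow (c := c) (α := α) hJ
  rw [lintegral_prod (fun p => ENNReal.ofReal (F (radialPower c α J p)))
    (hF.comp (measurable_radialPower hJ)).ennreal_ofReal.aemeasurable]
  have hk : Measurable fun r : ℝ =>
      ∫⁻ z, ENNReal.ofReal (F (J.indicator (fun r => c * r ^ (-α)) r * |z|)) ∂ν := by
    have : Measurable fun p : ℝ × ℝ =>
      ENNReal.ofReal (F (J.indicator (fun r => c * r ^ (-α)) p.1 * |p.2|)) := by fun_prop
    exact this.lintegral_prod_right'
  unfold radialPower
  rw [lintegral_fun_norm_plane (F := fun r =>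
    ∫⁻ z, ENNReal.ofReal (F (J.indicator (fun r => c * r ^ (-α)) r * |z|)) ∂ν) hk,
    ← setLIntegral_congr hIJ, ← lintegral_indicator measurableSet_Ioi, ← lintegral_indicator hJ]
  congr 2 with r
  by_cases hr : r ∈ J
  · rw [indicator_of_mem (hJ0 hr), indicator_of_mem hr]
    simp [hr]
  · simp [hr, hF0]

lemma lintegral_indicator_rpow_norm_lt_top (hα : 2 < α) (ha : 0 < a) (hJ : MeasurableSet J)
    (hJa : J ⊆ Ici a) :
    ∫⁻ y : Plane, ENNReal.ofReal (J.indicator (fun r => c * r ^ (-α)) ‖y‖) < ∞ := by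
  have hm := measurable_indicator_rpow (c := c) (α := α) hJ
  rw [lintegral_fun_norm_plane (F := fun r => ENNReal.ofReal (J.indicator (fun r => c * r ^ (-α)) r))
    (by fun_prop)]
  refine ENNReal.mul_lt_top ENNReal.ofReal_lt_top ?_
  -- The Jacobian `r` turns `r ^ (-α)` into `r ^ (1 - α)`, integrable at infinity exactly because `α
  -- > 2`; `a > 0` keeps away from the singularity at the origin.
  have hint : IntegrableOn (fun r : ℝ => c * r ^ (1 - α)) (Ici a) :=
    (integrableOn_Ici_iff_integrableOn_Ioi (by finiteness)).2
      ((integrableOn_Ioi_rpow_of_lt (by linarith) ha).const_mul c)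
  refine lt_of_le_of_lt ?_ hint.lintegral_lt_top
  rw [← lintegral_indicator measurableSet_Ioi, ← lintegral_indicator measurableSet_Ici]
  refine lintegral_mono fun r => ?_
  by_cases hr : r ∈ J
  · have hr0 : 0 < r := ha.trans_le (hJa hr)
    rw [indicator_of_mem (mem_Ioi.2 hr0), indicator_of_mem (hJa hr), indicator_of_mem hr,
      ← ENNReal.ofReal_mul hr0.le, sub_eq_add_neg, Real.rpow_add hr0, Real.rpow_one]
    exact ENNReal.ofReal_le_ofReal (le_of_eq (by ring))
  · refine le_of_eq_of_le ?_ zero_le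
    by_cases h0 : r ∈ Ioi (0 : ℝ)
    · rw [indicator_of_mem h0, indicator_of_notMem hr, ENNReal.ofReal_zero, mul_zero]
    · rw [indicator_of_notMem h0]

lemma lintegral_radialPower_lt_top [SFinite ν] (hα : 2 < α) (ha : 0 < a) (hJ : MeasurableSet J)
    (hJa : J ⊆ Ici a) (hc : 0 ≤ c) (hν : Integrable (fun z : ℝ => z) ν) :
    ∫⁻ p, ENNReal.ofReal (radialPower c α J p) ∂volume.prod ν < ∞ := by
  have hm := measurable_indicator_rpow (c := c) (α := α) hJ
  have hJ0 : J ⊆ Ioi 0 := fun r hr => ha.trans_le (hJa hr)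
  simp only [radialPower, ENNReal.ofReal_mul (indicator_rpow_nonneg hc hJ0 _)]
  rw [lintegral_prod_mul (f := fun y : Plane =>
    ENNReal.ofReal (J.indicator (fun r => c * r ^ (-α)) ‖y‖)) (g := fun z => ENNReal.ofReal |z|)
    (Measurable.aemeasurable (by fun_prop)) (Measurable.aemeasurable (by fun_prop))]
  exact ENNReal.mul_lt_top (lintegral_indicator_rpow_norm_lt_top hα ha hJ hJa)
    hν.abs.lintegral_lt_top

lemma lintegral_one_sub_exp_radialPower_lt_top [SFinite ν] (hα : 2 < α) (ha : 0 < a)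
    (hJ : MeasurableSet J) (hJa : J ⊆ Ici a) (hc : 0 ≤ c)
    (hν : Integrable (fun z : ℝ => z) ν) :
    ∫⁻ p, ENNReal.ofReal (1 - Real.exp (-radialPower c α J p)) ∂volume.prod ν < ∞ := by
  refine (lintegral_mono fun p => ENNReal.ofReal_le_ofReal ?_).trans_lt
    (lintegral_radialPower_lt_top hα ha hJ hJa hc hν)
  linarith [Real.add_one_le_exp (-radialPower c α J p)]

/-- Campbell's theorem: almost sure finiteness of the total power. -/
lemma IsHomogeneousPPPOn.ae_summable_radialPower {Ω : Type*} [MeasurableSpace Ω] {μ : Measure Ω}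
    [IsProbabilityMeasure μ] {S : Set Plane} {lam : ℝ≥0} {x : ℕ → Ω → Plane} {g : ℕ → Ω → ℝ}
    (hx : IsHomogeneousPPPOn S lam x μ) (hS : MeasurableSet S)
    (hg : ∀ i, Measurable (g i)) (hgν : ∀ i, μ.map (g i) = ν)
    (hxg : IndepFun (fun ω i => x i ω) (fun ω i => g i ω) μ) (hα : 2 < α) (ha : 0 < a)
    (hJ : MeasurableSet J) (hJa : J ⊆ Ici a) (hJS : ∀ y : Plane, ‖y‖ ∈ J → y ∈ S) (hc : 0 ≤ c)
    (hν : Integrable (fun z : ℝ => z) ν) :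
    ∀ᵐ ω ∂μ, Summable fun i => radialPower c α J (x i ω, g i ω) := by
  have hJ0 : J ⊆ Ioi 0 := fun r hr => ha.trans_le (hJa hr)
  have hm := measurable_indicator_rpow (c := c) (α := α) hJ
  have h := hx.lintegral_tsum_mul_marks hS hg hgν hxg
    (p := fun y => ENNReal.ofReal (J.indicator (fun r => c * r ^ (-α)) ‖y‖)) (by fun_prop)
    (fun y hy => by rw [indicator_of_notMem fun h => hy (hJS y h), ENNReal.ofReal_zero])
    (q := fun z => ENNReal.ofReal |z|) (by fun_prop)
  have hfin : ∫⁻ ω, ∑' i, ENNReal.ofReal (radialPower c α J (x i ω, g i ω)) ∂μ ≠ ∞ := by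
    simp only [radialPower, ENNReal.ofReal_mul (indicator_rpow_nonneg hc hJ0 _)]
    rw [h]
    refine (ENNReal.mul_lt_top (ENNReal.mul_lt_top ENNReal.coe_lt_top
      ((setLIntegral_le_lintegral _ _).trans_lt
        (lintegral_indicator_rpow_norm_lt_top hα ha hJ hJa))) hν.abs.lintegral_lt_top).ne
  have hmeas : Measurable fun ω => ∑' i, ENNReal.ofReal (radialPower c α J (x i ω, g i ω)) :=
    Measurable.tsum fun i =>
      ((measurable_radialPower hJ).comp ((hx.measurable i).prodMk (hg i))).ennreal_ofReal
  filter_upwards [ae_lt_top hmeas hfin] with ω hω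
  have := ENNReal.summable_toReal hω.ne
  simpa only [ENNReal.toReal_ofReal (radialPower_nonneg hc hJ0 _)] using this

/-- Passage from integrals in `[0, ∞]` to Bochner integrals. `hint` is essential: the Bochner
integral of a non-integrable slice is `0` by convention, which would hide an infinite value. -/
lemma radial_lintegral_eq_integral [SFinite ν] (hI : MeasurableSet I) (hI0 : I ⊆ Ioi 0)
    {k : ℝ × ℝ → ℝ} (hk : Measurable k) (hk0 : ∀ r ∈ I, ∀ z, 0 ≤ k (r, z))
    (hint : ∀ r ∈ I, Integrable (fun z => k (r, z)) ν) :
    (∫⁻ r in I, ENNReal.ofReal r * ∫⁻ z, ENNReal.ofReal (k (r, z)) ∂ν ≠ ∞ ↔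
      IntegrableOn (fun r => (∫ z, k (r, z) ∂ν) * r) I) ∧
    (∫⁻ r in I, ENNReal.ofReal r * ∫⁻ z, ENNReal.ofReal (k (r, z)) ∂ν).toReal =
      ∫ r in I, (∫ z, k (r, z) ∂ν) * r := by
  have hmeas : AEStronglyMeasurable (fun r => (∫ z, k (r, z) ∂ν) * r) (volume.restrict I) :=
    (hk.stronglyMeasurable.integral_prod_right'.mul stronglyMeasurable_id).aestronglyMeasurable
  have hnonneg : 0 ≤ᵐ[volume.restrict I] fun r => (∫ z, k (r, z) ∂ν) * r := by
    filter_upwards [ae_restrict_mem hI] with r hr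
    exact mul_nonneg (integral_nonneg (hk0 r hr)) (hI0 hr).le
  have heq : ∫⁻ r in I, ENNReal.ofReal r * ∫⁻ z, ENNReal.ofReal (k (r, z)) ∂ν =
      ∫⁻ r in I, ENNReal.ofReal ((∫ z, k (r, z) ∂ν) * r) := by
    refine setLIntegral_congr_fun hI fun r hr => ?_
    rw [mul_comm (∫ z, k (r, z) ∂ν), ENNReal.ofReal_mul (hI0 hr).le,
      ofReal_integral_eq_lintegral_ofReal (hint r hr) (Eventually.of_forall (hk0 r hr))]
  rw [heq]
  refine ⟨?_, (integral_eq_lintegral_of_nonneg_ae hnonneg hmeas).symm⟩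
  exact lintegral_ofReal_ne_top_iff_integrable hmeas hnonneg

/-- The absolute value in `radialPower` makes the power non-negative everywhere; it is invisible to
a law on the non-negative reals. -/
lemma mgfExists_iff_integrable_abs (hν0 : ∀ᵐ z ∂ν, 0 ≤ z) (s : ℝ) :
    MGFExists (fun z => z) ν s ↔ Integrable (fun z => Real.exp (-s * |z|)) ν :=
  integrable_congr (hν0.mono fun z hz => by simp only [abs_of_nonneg hz])

lemma negMGF_eq_integral_abs (hν0 : ∀ᵐ z ∂ν, 0 ≤ z) (s : ℝ) :
    negMGF (fun z => z) ν s = ∫ z, Real.exp (-s * |z|) ∂ν :=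
  integral_congr_ae (hν0.mono fun z hz => by simp only [abs_of_nonneg hz])

/-- A finite radial integral gives finite inner integrals at almost every radius. Since `r ^ (-α)`
decreases in `r`, finiteness at some `u < r` implies it at `r`, and openness of `I` makes such radii
a set of positive measure. -/
lemma integrable_exp_mul_abs_of_lintegral_ne_top [IsProbabilityMeasure ν] (hI : IsOpen I)
    (hI0 : I ⊆ Ioi 0) (hα : 0 < α) (hc : 0 ≤ c)
    (h : ∫⁻ r in I, ENNReal.ofReal r *
      ∫⁻ z, ENNReal.ofReal (Real.exp (c * r ^ (-α) * |z|) - 1) ∂ν ≠ ∞) {r : ℝ} (hr : r ∈ I) :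
    Integrable (fun z => Real.exp (c * r ^ (-α) * |z|)) ν := by
  have hkm : Measurable fun p : ℝ × ℝ => ENNReal.ofReal (Real.exp (c * p.1 ^ (-α) * |p.2|) - 1) := by
    fun_prop
  have hae := ae_lt_top' (ENNReal.measurable_ofReal.mul hkm.lintegral_prod_right').aemeasurable h
  have hO : IsOpen (I ∩ Iio r) := hI.inter isOpen_Iio
  have hne : (I ∩ Iio r).Nonempty :=
    nonempty_of_mem (f := 𝓝[<] r)
      (inter_mem (mem_nhdsWithin_of_mem_nhds (hI.mem_nhds hr)) self_mem_nhdsWithin)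
  have : NeZero (volume.restrict (I ∩ Iio r)) :=
    ⟨fun h0 => (hO.measure_pos volume hne).ne' (Measure.restrict_eq_zero.1 h0)⟩
  obtain ⟨u, hu, huI, hur⟩ := ((ae_restrict_of_ae_restrict_of_subset inter_subset_left hae).and
    (ae_restrict_mem hO.measurableSet)).exists
  have hu0 : 0 < u := hI0 huI
  have hfin : ∫⁻ z, ENNReal.ofReal (Real.exp (c * u ^ (-α) * |z|) - 1) ∂ν ≠ ∞ := fun htop => by
    have hu0' : ENNReal.ofReal u ≠ 0 := (ENNReal.ofReal_pos.2 hu0).ne'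
    simp only [Pi.mul_apply] at hu
    rw [htop, ENNReal.mul_top hu0'] at hu
    exact hu.ne rfl
  have hnn : ∀ z : ℝ, 0 ≤ c * u ^ (-α) * |z| := fun z =>
    mul_nonneg (mul_nonneg hc (Real.rpow_nonneg hu0.le _)) (abs_nonneg _)
  have hint : Integrable (fun z => Real.exp (c * u ^ (-α) * |z|) - 1) ν :=
    (lintegral_ofReal_ne_top_iff_integrable (Measurable.aestronglyMeasurable (by fun_prop))
      (Eventually.of_forall fun z => by simpa using hnn z)).1 hfin
  refine Integrable.mono' (hint.add (integrable_const (1 : ℝ)))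
    (Measurable.aestronglyMeasurable (by fun_prop)) (Eventually.of_forall fun z => ?_)
  rw [Real.norm_of_nonneg (Real.exp_pos _).le]
  simp only [Pi.add_apply, sub_add_cancel]
  refine Real.exp_le_exp.2 (mul_le_mul_of_nonneg_right (mul_le_mul_of_nonneg_left ?_ hc)
    (abs_nonneg _))
  exact Real.rpow_le_rpow_of_nonpos hu0 (le_of_lt hur) (by linarith)

/-- The growing exponential, where existence is a genuine condition. Existence of every `M_G` value
must be listed separately, as `negMGF` takes the default value `0` where it fails. -/
lemma lintegral_exp_radialPower_sub_one [IsProbabilityMeasure ν] (hν0 : ∀ᵐ z ∂ν, 0 ≤ z)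
    (hI : IsOpen I) (hI0 : I ⊆ Ioi 0) (hJ : MeasurableSet J) (hJ0 : J ⊆ Ioi 0)
    (hIJ : J =ᵐ[volume] I) (hα : 0 < α) (hs : s ≤ 0) :
    (∫⁻ p, ENNReal.ofReal (Real.exp (radialPower (-s) α J p) - 1) ∂volume.prod ν ≠ ∞ ↔
      (∀ r ∈ I, MGFExists (fun z => z) ν (s * r ^ (-α))) ∧
        IntegrableOn (fun r => (negMGF (fun z => z) ν (s * r ^ (-α)) - 1) * r) I) ∧
    (∫⁻ p, ENNReal.ofReal (Real.exp (radialPower (-s) α J p) - 1) ∂volume.prod ν ≠ ∞ →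
      (∫⁻ p, ENNReal.ofReal (Real.exp (radialPower (-s) α J p) - 1) ∂volume.prod ν).toReal =
        2 * Real.pi * ∫ r in I, (negMGF (fun z => z) ν (s * r ^ (-α)) - 1) * r) := by
  have hpi : 0 < 2 * Real.pi := Real.two_pi_pos
  simp_rw [mgfExists_iff_integrable_abs hν0, negMGF_eq_integral_abs hν0, ← neg_mul]
  rw [lintegral_comp_radialPower hJ hJ0 hIJ (F := fun u => Real.exp u - 1) (by fun_prop) (by simp)]
  have hfin : ENNReal.ofReal (2 * Real.pi) * ∫⁻ r in I, ENNReal.ofReal r *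
      ∫⁻ z, ENNReal.ofReal (Real.exp (-s * r ^ (-α) * |z|) - 1) ∂ν ≠ ∞ ↔
      ∫⁻ r in I, ENNReal.ofReal r *
        ∫⁻ z, ENNReal.ofReal (Real.exp (-s * r ^ (-α) * |z|) - 1) ∂ν ≠ ∞ := by
    rw [not_iff_not, ENNReal.mul_eq_top]
    simp only [ne_eq, (ENNReal.ofReal_pos.2 hpi).ne', ENNReal.ofReal_ne_top, not_false_eq_true,
      true_and, false_and, or_false]
  have key := fun hint : ∀ r ∈ I, Integrable (fun z => Real.exp (-s * r ^ (-α) * |z|)) ν =>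
    radial_lintegral_eq_integral (ν := ν) hI.measurableSet hI0
      (k := fun p => Real.exp (-s * p.1 ^ (-α) * |p.2|) - 1) (by fun_prop) (fun r hr z => by
        simpa using mul_nonneg (mul_nonneg (neg_nonneg.2 hs) (Real.rpow_nonneg (hI0 hr).le (-α)))
          (abs_nonneg z)) fun r hr => (hint r hr).sub (integrable_const 1)
  have hcongr : ∀ hint : ∀ r ∈ I, Integrable (fun z => Real.exp (-s * r ^ (-α) * |z|)) ν,
      EqOn (fun r => (∫ z, (Real.exp (-s * r ^ (-α) * |z|) - 1) ∂ν) * r)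
        (fun r => (∫ z, Real.exp (-s * r ^ (-α) * |z|) ∂ν - 1) * r) I := fun hint r hr => by
    simp only
    rw [integral_sub (hint r hr) (integrable_const 1)]
    simp
  have hall := fun h => fun r => integrable_exp_mul_abs_of_lintegral_ne_top (ν := ν) (r := r) hI hI0 hα
    (neg_nonneg.2 hs) h
  rw [hfin]
  refine ⟨⟨fun h => ⟨hall h, ?_⟩, fun h => ?_⟩, fun h => ?_⟩
  · exact ((key (hall h)).1.1 h).congr_fun (hcongr (hall h)) hI.measurableSet
  · exact (key h.1).1.2 (h.2.congr_fun (hcongr h.1).symm hI.measurableSet)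
  · rw [ENNReal.toReal_mul, ENNReal.toReal_ofReal hpi.le, (key (hall h)).2,
      setIntegral_congr_fun hI.measurableSet (hcongr (hall h))]

/-- The decaying exponential is bounded by `1` and its radial integral is controlled by `𝔼 G`, so
here nothing has to be assumed about `M_G`. -/
lemma lintegral_one_sub_exp_radialPower [IsProbabilityMeasure ν] (hν0 : ∀ᵐ z ∂ν, 0 ≤ z)
    (hν : Integrable (fun z : ℝ => z) ν) (hI : MeasurableSet I) (hI0 : I ⊆ Ioi 0)
    (hJ : MeasurableSet J) (hIJ : J =ᵐ[volume] I) (hα : 2 < α) (ha : 0 < a) (hJa : J ⊆ Ici a)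
    (hs : 0 ≤ s) :
    ((∀ r ∈ I, MGFExists (fun z => z) ν (s * r ^ (-α))) ∧
        IntegrableOn (fun r => (negMGF (fun z => z) ν (s * r ^ (-α)) - 1) * r) I) ∧
    -(∫⁻ p, ENNReal.ofReal (1 - Real.exp (-radialPower s α J p)) ∂volume.prod ν).toReal =
        2 * Real.pi * ∫ r in I, (negMGF (fun z => z) ν (s * r ^ (-α)) - 1) * r := by
  have hpi : 0 < 2 * Real.pi := Real.two_pi_pos
  have hJ0 : J ⊆ Ioi 0 := fun r hr => ha.trans_le (hJa hr)
  have hfin := (lintegral_one_sub_exp_radialPower_lt_top hα ha hJ hJa hs hν).ne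
  simp_rw [mgfExists_iff_integrable_abs hν0, negMGF_eq_integral_abs hν0, neg_mul]
  rw [lintegral_comp_radialPower hJ hJ0 hIJ (F := fun u => 1 - Real.exp (-u)) (by fun_prop)
    (by simp)] at hfin ⊢
  have hfin' : ∫⁻ r in I, ENNReal.ofReal r *
      ∫⁻ z, ENNReal.ofReal (1 - Real.exp (-(s * r ^ (-α) * |z|))) ∂ν ≠ ∞ := fun h => by
    rw [h, ENNReal.mul_top (ENNReal.ofReal_pos.2 hpi).ne'] at hfin
    exact hfin rfl
  have hnn : ∀ r ∈ I, ∀ z : ℝ, 0 ≤ s * r ^ (-α) * |z| := fun r hr z =>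
    mul_nonneg (mul_nonneg hs (Real.rpow_nonneg (hI0 hr).le (-α))) (abs_nonneg z)
  have hint : ∀ r ∈ I, Integrable (fun z => Real.exp (-(s * r ^ (-α) * |z|))) ν := fun r hr =>
    Integrable.of_bound (Measurable.aestronglyMeasurable (by fun_prop)) 1
      (Eventually.of_forall fun z => by simpa using hnn r hr z)
  have key := radial_lintegral_eq_integral (ν := ν) hI hI0
      (k := fun p => 1 - Real.exp (-(s * p.1 ^ (-α) * |p.2|))) (by fun_prop) (fun r hr z => by
        simpa using hnn r hr z) fun r hr => (integrable_const 1).sub (hint r hr)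
  have hcongr : EqOn (fun r => (∫ z, (1 - Real.exp (-(s * r ^ (-α) * |z|))) ∂ν) * r)
        (fun r => -((∫ z, Real.exp (-(s * r ^ (-α) * |z|)) ∂ν - 1) * r)) I := fun r hr => by
    simp only
    rw [integral_sub (integrable_const 1) (hint r hr)]
    simp
    ring
  refine ⟨⟨hint, ?_⟩, ?_⟩
  · simpa using ((key.1.1 hfin').congr_fun hcongr hI).neg
  · rw [ENNReal.toReal_mul, ENNReal.toReal_ofReal hpi.le, key.2, setIntegral_congr_fun hI hcongr,
      integral_neg]
    ring

end RadialSums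

/-! ### From exponential moments to the cumulant generating function -/

section CumulantGeneratingFunction

lemma mgfExists_map_iff {Ω' : Type*} [MeasurableSpace Ω'] {μ' : Measure Ω'} {G : Ω' → ℝ}
    (hG : AEMeasurable G μ') (s : ℝ) :
    MGFExists (fun z => z) (μ'.map G) s ↔ MGFExists G μ' s :=
  integrable_map_measure (Measurable.aestronglyMeasurable (by fun_prop)) hG

lemma negMGF_map {Ω' : Type*} [MeasurableSpace Ω'] {μ' : Measure Ω'} {G : Ω' → ℝ}
    (hG : AEMeasurable G μ') (s : ℝ) :
    negMGF (fun z => z) (μ'.map G) s = negMGF G μ' s :=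
  integral_map hG (Measurable.aestronglyMeasurable (by fun_prop))

/-- The exponential moment of a difference of the powers received from two disjoint regions, with
coefficients of opposite signs. -/
theorem IsHomogeneousPPPOn.mgf_radialPower {Ω : Type*} [MeasurableSpace Ω] {μ : Measure Ω}
    [IsProbabilityMeasure μ] {ν : Measure ℝ} [IsProbabilityMeasure ν] {lam : ℝ≥0}
    {x : ℕ → Ω → Plane} {g : ℕ → Ω → ℝ} {a α s₁ s₂ : ℝ} {I₁ I₂ J₁ J₂ : Set ℝ}
    (hx : IsHomogeneousPPPOn {y : Plane | a ≤ ‖y‖} lam x μ) (hlam : 0 < lam)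
    (hg : ∀ i, Measurable (g i)) (hgν : ∀ i, μ.map (g i) = ν) (hi : iIndepFun g μ)
    (hxg : IndepFun (fun ω i => x i ω) (fun ω i => g i ω) μ)
    (hν0 : ∀ᵐ z ∂ν, 0 ≤ z) (hν : Integrable (fun z : ℝ => z) ν) (hα : 2 < α) (ha : 0 < a)
    (hI₁ : IsOpen I₁) (hI₂ : MeasurableSet I₂) (hI₁0 : I₁ ⊆ Ioi 0) (hI₂0 : I₂ ⊆ Ioi 0)
    (hJ₁ : MeasurableSet J₁) (hJ₂ : MeasurableSet J₂) (hJ₁a : J₁ ⊆ Ici a) (hJ₂a : J₂ ⊆ Ici a)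
    (hIJ₁ : J₁ =ᵐ[volume] I₁) (hIJ₂ : J₂ =ᵐ[volume] I₂) (hd : Disjoint J₁ J₂)
    (hs₁ : s₁ ≤ 0) (hs₂ : 0 ≤ s₂) {Z : Ω → ℝ} {t : ℝ}
    (hZ : ∀ᵐ ω ∂μ, -t * Z ω = ∑' i, radialPower (-s₁) α J₁ (x i ω, g i ω) -
      ∑' i, radialPower s₂ α J₂ (x i ω, g i ω)) :
    ((∀ r ∈ I₂, MGFExists (fun z => z) ν (s₂ * r ^ (-α))) ∧
      IntegrableOn (fun r => (negMGF (fun z => z) ν (s₂ * r ^ (-α)) - 1) * r) I₂) ∧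
    (MGFExists Z μ t ↔ (∀ r ∈ I₁, MGFExists (fun z => z) ν (s₁ * r ^ (-α))) ∧
      IntegrableOn (fun r => (negMGF (fun z => z) ν (s₁ * r ^ (-α)) - 1) * r) I₁) ∧
    (MGFExists Z μ t → negCGF Z μ t = 2 * Real.pi * lam *
      ((∫ r in I₁, (negMGF (fun z => z) ν (s₁ * r ^ (-α)) - 1) * r) +
        ∫ r in I₂, (negMGF (fun z => z) ν (s₂ * r ^ (-α)) - 1) * r)) := by
  have hS : MeasurableSet {y : Plane | a ≤ ‖y‖} := measurableSet_le (by fun_prop) (by fun_prop)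
  have hJ₁0 : J₁ ⊆ Ioi 0 := fun r hr => ha.trans_le (hJ₁a hr)
  have hJ₂0 : J₂ ⊆ Ioi 0 := fun r hr => ha.trans_le (hJ₂a hr)
  have hc₁ : 0 ≤ -s₁ := neg_nonneg.2 hs₁
  have hsum₁ := hx.ae_summable_radialPower (α := α) hS hg hgν hxg hα ha hJ₁ hJ₁a
    (fun y hy => hJ₁a hy) hc₁ hν
  have hsum₂ := hx.ae_summable_radialPower (α := α) hS hg hgν hxg hα ha hJ₂ hJ₂a
    (fun y hy => hJ₂a hy) hs₂ hν
  obtain ⟨hiff, hval⟩ := hx.lintegral_exp_tsum_sub_tsum hlam hS hg hgν hi hxg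
    (measurable_radialPower hJ₁) (measurable_radialPower hJ₂) (radialPower_nonneg hc₁ hJ₁0)
    (radialPower_nonneg hs₂ hJ₂0)
    (fun y hy z => by
      rw [radialPower, indicator_of_notMem fun h => hy (hJ₁a h), zero_mul])
    (fun y hy z => by
      rw [radialPower, indicator_of_notMem fun h => hy (hJ₂a h), zero_mul])
    (fun p => by
      by_cases hp : ‖p.1‖ ∈ J₁
      · exact Or.inr (by rw [radialPower, indicator_of_notMem (disjoint_left.1 hd hp), zero_mul])
      · exact Or.inl (by rw [radialPower, indicator_of_notMem hp, zero_mul]))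
    hsum₁ hsum₂ (lintegral_one_sub_exp_radialPower_lt_top hα ha hJ₂ hJ₂a hs₂ hν).ne
  have hneg := lintegral_one_sub_exp_radialPower hν0 hν hI₂ hI₂0 hJ₂ hIJ₂ hα ha hJ₂a hs₂
  have hpos := lintegral_exp_radialPower_sub_one hν0 hI₁ hI₁0 hJ₁ hJ₁0 hIJ₁ (two_pos.trans hα) hs₁
  have hw : ∀ i, Measurable fun ω => (x i ω, g i ω) := fun i => (hx.measurable i).prodMk (hg i)
  have hm : AEMeasurable (fun ω => Real.exp (-t * Z ω)) μ := by
    refine AEMeasurable.congr (((aemeasurable_tsum_of_summable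
      (fun i => ((measurable_radialPower hJ₁).comp (hw i)).aemeasurable) hsum₁).sub
      (aemeasurable_tsum_of_summable
      (fun i => ((measurable_radialPower hJ₂).comp (hw i)).aemeasurable) hsum₂)).exp) ?_
    filter_upwards [hZ] with ω hω
    rw [hω]
    rfl
  have hlint : ∫⁻ ω, ENNReal.ofReal (Real.exp (-t * Z ω)) ∂μ =
      ∫⁻ ω, ENNReal.ofReal (Real.exp (∑' i, radialPower (-s₁) α J₁ (x i ω, g i ω) -
        ∑' i, radialPower s₂ α J₂ (x i ω, g i ω))) ∂μ :=
    lintegral_congr_ae (hZ.mono fun ω hω => by simp only [hω])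
  have hnn : 0 ≤ᵐ[μ] fun ω => Real.exp (-t * Z ω) := ae_of_all _ fun ω => (Real.exp_pos _).le
  -- Only the region with the growing exponential decides existence.
  have hex : MGFExists Z μ t ↔
      ∫⁻ p, ENNReal.ofReal (Real.exp (radialPower (-s₁) α J₁ p) - 1) ∂volume.prod ν ≠ ∞ := by
    rw [← hiff, ← hlint, lintegral_ofReal_ne_top_iff_integrable hm.aestronglyMeasurable hnn]
    rfl
  refine ⟨hneg.1, hex.trans hpos.1, fun h => ?_⟩
  have hU := hex.1 h
  rw [negCGF, negMGF, integral_eq_lintegral_of_nonneg_ae hnn hm.aestronglyMeasurable, hlint,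
    hval hU, ENNReal.toReal_ofReal (Real.exp_pos _).le, Real.log_exp, hpos.2 hU, sub_eq_add_neg,
    hneg.2]
  ring

lemma powerTerm_eq_radialPower {Ω : Type*} {P α : ℝ} {x : ℕ → Ω → Plane} {g : ℕ → Ω → ℝ}
    {A : Set Plane} {J : Set ℝ} (hA : A = {y | ‖y‖ ∈ J}) {ω : Ω} {i : ℕ} (h : 0 ≤ g i ω) :
    powerTerm P α x g A ω i = radialPower P α J (x i ω, g i ω) := by
  subst hA
  rw [powerTerm, radialPower, abs_of_nonneg h]
  by_cases hi : ‖x i ω‖ ∈ J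
  · rw [if_pos (by exact hi), indicator_of_mem hi]
    ring
  · rw [if_neg (by exact hi), indicator_of_notMem hi, zero_mul]

lemma mul_tsum_radialPower (b c α : ℝ) (J : Set ℝ) (w : ℕ → Plane × ℝ) :
    b * ∑' i, radialPower c α J (w i) = ∑' i, radialPower (b * c) α J (w i) := by
  rw [← tsum_mul_left]
  refine tsum_congr fun i => ?_
  by_cases h : ‖(w i).1‖ ∈ J
  · simp only [radialPower, indicator_of_mem h]
    ring
  · simp only [radialPower, indicator_of_notMem h, zero_mul, mul_zero]

end CumulantGeneratingFunction

/-! ### Assembly: measurable versions of the gains and the two signs of `t` -/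

theorem lemma2 {Ω Ω' : Type*} [MeasurableSpace Ω] [MeasurableSpace Ω']
    (μ : Measure Ω) [IsProbabilityMeasure μ] (μ' : Measure Ω') [IsProbabilityMeasure μ']
    (lam : ℝ≥0) (P α a R θ : ℝ)
    (hlam : 0 < lam) (hP : 0 < P) (hα : 2 < α) (ha : 0 < a) (haR : a < R) (hθ : 0 < θ)
    (G : Ω' → ℝ) (hG_nonneg : ∀ᵐ ω ∂μ', 0 ≤ G ω) (hG_mean : Integrable G μ')
    (x : ℕ → Ω → Plane) (hx : IsHomogeneousPPPOn {y : Plane | a ≤ ‖y‖} lam x μ)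
    (g : ℕ → Ω → ℝ) (hg : IsIIDMarking g x μ G μ') :
    -- the useful power and the interference are almost surely finite sums
    (∀ᵐ ω ∂μ, Summable (powerTerm P α x g (coopRegion a R) ω)) ∧
    (∀ᵐ ω ∂μ, Summable (powerTerm P α x g (interfRegion R) ω)) ∧
    ∀ t : ℝ,
      -- the generating function is finite at `t` exactly when the two integrals make sense
      (MGFExists (outageVar P α a R θ x g) μ t ↔
        ((∀ r ∈ Ioo a R, MGFExists G μ' (-t * P * r ^ (-α))) ∧
          IntegrableOn (fun r : ℝ => (negMGF G μ' (-t * P * r ^ (-α)) - 1) * r) (Ioo a R)) ∧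
        ((∀ r ∈ Ioi R, MGFExists G μ' (t * θ * P * r ^ (-α))) ∧
          IntegrableOn (fun r : ℝ => (negMGF G μ' (t * θ * P * r ^ (-α)) - 1) * r) (Ioi R))) ∧
      -- and then it is given by the formula
      (MGFExists (outageVar P α a R θ x g) μ t →
        negCGF (outageVar P α a R θ x g) μ t =
          2 * Real.pi * lam *
            ((∫ r in a..R, (negMGF G μ' (-t * P * r ^ (-α)) - 1) * r) +
              ∫ r in Ioi R, (negMGF G μ' (t * θ * P * r ^ (-α)) - 1) * r)) := by
  have hGm : AEMeasurable G μ' := hG_mean.aemeasurable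
  set ν := μ'.map G with hν_def
  have hνP : IsProbabilityMeasure ν := Measure.isProbabilityMeasure_map hGm
  have hν0 : ∀ᵐ z ∂ν, 0 ≤ z := (ae_map_iff hGm measurableSet_Ici).2 hG_nonneg
  have hν : Integrable (fun z : ℝ => z) ν :=
    (integrable_map_measure (by fun_prop) hGm).2 hG_mean
  have hgm : ∀ i, AEMeasurable (g i) μ := fun i => (hg.identDistrib i).aemeasurable_fst
  -- Identical distribution gives only almost everywhere measurable gains. Countably many null sets
  -- are discarded to pass to measurable versions.
  set g' : ℕ → Ω → ℝ := fun i => (hgm i).mk (g i)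
  have hgg' : ∀ i, g i =ᵐ[μ] g' i := fun i => (hgm i).ae_eq_mk
  have hg' : ∀ i, Measurable (g' i) := fun i => (hgm i).measurable_mk
  have hg'ν : ∀ i, μ.map (g' i) = ν := fun i => by
    rw [← Measure.map_congr (hgg' i), (hg.identDistrib i).map_eq]
  have hi : iIndepFun g' μ := hg.indep.congr hgg'
  have hall : ∀ᵐ ω ∂μ, ∀ i, g i ω = g' i ω := ae_all_iff.2 hgg'
  have hxg : IndepFun (fun ω i => x i ω) (fun ω i => g' i ω) μ :=
    hg.indep_points.congr (ae_eq_refl _) (hall.mono fun ω hω => funext hω)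
  have hg'0 : ∀ᵐ ω ∂μ, ∀ i, 0 ≤ g' i ω := ae_all_iff.2 fun i =>
    (ae_map_iff (hg' i).aemeasurable measurableSet_Ici).1 ((hg'ν i).symm ▸ hν0)
  have hR : 0 < R := ha.trans haR
  have hS : MeasurableSet {y : Plane | a ≤ ‖y‖} := measurableSet_le (by fun_prop) (by fun_prop)
  have hcoop : Ico a R ⊆ Ici a := fun r hr => hr.1
  have hinterf : Ici R ⊆ Ici a := Ici_subset_Ici.2 haR.le
  have hterm₁ : ∀ᵐ ω ∂μ, ∀ i, powerTerm P α x g (coopRegion a R) ω i =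
      radialPower P α (Ico a R) (x i ω, g' i ω) := by
    filter_upwards [hall, hg'0] with ω h₁ h₂ i
    have h := powerTerm_eq_radialPower (P := P) (α := α) (x := x) (g := g) (J := Ico a R)
      (A := coopRegion a R) (Set.ext fun _ => Iff.rfl) ((h₂ i).trans_eq (h₁ i).symm)
    rwa [h₁] at h
  have hterm₂ : ∀ᵐ ω ∂μ, ∀ i, powerTerm P α x g (interfRegion R) ω i =
      radialPower P α (Ici R) (x i ω, g' i ω) := by
    filter_upwards [hall, hg'0] with ω h₁ h₂ i
    have h := powerTerm_eq_radialPower (P := P) (α := α) (x := x) (g := g) (J := Ici R)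
      (A := interfRegion R) (Set.ext fun _ => Iff.rfl) ((h₂ i).trans_eq (h₁ i).symm)
    rwa [h₁] at h
  have hout : ∀ᵐ ω ∂μ, outageVar P α a R θ x g ω =
      θ * ∑' i, radialPower P α (Ici R) (x i ω, g' i ω) -
        ∑' i, radialPower P α (Ico a R) (x i ω, g' i ω) := by
    filter_upwards [hterm₁, hterm₂] with ω h₁ h₂
    rw [outageVar, totalPower, totalPower, tsum_congr h₁, tsum_congr h₂]
  refine ⟨?_, ?_, fun t => ?_⟩
  · filter_upwards [hterm₁, hx.ae_summable_radialPower hS hg' hg'ν hxg hα ha measurableSet_Ico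
      hcoop (fun y hy => hy.1) hP.le hν] with ω h₁ h₂
    exact h₂.congr fun i => (h₁ i).symm
  · filter_upwards [hterm₂, hx.ae_summable_radialPower hS hg' hg'ν hxg hα ha measurableSet_Ici
      hinterf (fun y hy => haR.le.trans hy) hP.le hν] with ω h₁ h₂
    exact h₂.congr fun i => (h₁ i).symm
  have hd : Disjoint (Ico a R) (Ici R) :=
    disjoint_left.2 fun r hr hr' => (mem_Ico.1 hr).2.not_ge hr'
  have hI₁0 : Ioo a R ⊆ Ioi 0 := fun r hr => ha.trans hr.1
  have hI₂0 : Ioi R ⊆ Ioi 0 := Ioi_subset_Ioi hR.le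
  rw [intervalIntegral.integral_of_le haR.le, integral_Ioc_eq_integral_Ioo]
  simp_rw [← mgfExists_map_iff hGm, ← negMGF_map hGm, ← hν_def]
  -- For `t ≥ 0` the useful signal carries the growing exponential and the conditions on the
  -- interference hold automatically; for `t ≤ 0` the roles are exchanged.
  rcases le_total 0 t with ht | ht
  · obtain ⟨h₂, h₁, hval⟩ := hx.mgf_radialPower (s₁ := -t * P) (s₂ := t * θ * P) hlam hg' hg'ν hi
      hxg hν0 hν hα ha isOpen_Ioo measurableSet_Ioi hI₁0 hI₂0 measurableSet_Ico measurableSet_Ici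
      hcoop hinterf Ioo_ae_eq_Ico.symm Ioi_ae_eq_Ici.symm hd
      (mul_nonpos_of_nonpos_of_nonneg (neg_nonpos.2 ht) hP.le) (by positivity)
      (Z := outageVar P α a R θ x g) (t := t) (hout.mono fun ω hω => by
        rw [hω, show -(-t * P) = t * P by ring, ← mul_tsum_radialPower, ← mul_tsum_radialPower]
        ring)
    exact ⟨⟨fun h => ⟨h₁.1 h, h₂⟩, fun h => h₁.2 h.1⟩, hval⟩
  · obtain ⟨h₂, h₁, hval⟩ := hx.mgf_radialPower (s₁ := t * θ * P) (s₂ := -t * P) hlam hg' hg'ν hi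
      hxg hν0 hν hα ha isOpen_Ioi measurableSet_Ioo hI₂0 hI₁0 measurableSet_Ici measurableSet_Ico
      hinterf hcoop Ioi_ae_eq_Ici.symm Ioo_ae_eq_Ico.symm hd.symm
      (mul_nonpos_of_nonpos_of_nonneg (mul_nonpos_of_nonpos_of_nonneg ht hθ.le) hP.le)
      (mul_nonneg (neg_nonneg.2 ht) hP.le)
      (Z := outageVar P α a R θ x g) (t := t) (hout.mono fun ω hω => by
        rw [hω, show -(t * θ * P) = (-t * θ) * P by ring, ← mul_tsum_radialPower,
          ← mul_tsum_radialPower]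
        ring)
    exact ⟨⟨fun h => ⟨h₂, h₁.1 h⟩, fun h => h₁.2 h.2⟩, fun h => by rw [hval h, add_comm]⟩
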